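/- **Theorem 2.1.** Let $n\ge 1$, $1<p<\infty$, $\mathbf A>0$ and $\delta\in(0,1)$. Functions on $\mathbb R^n$ are all real-valued, or all complex-valued. Let $\mathcal D$ be the standard dyadic grid, i.e. the cubes $2^{-k}(m+[0,1)^n)$ with $k\in\mathbb Z$, $m\in\mathbb Z^n$; let $\mathrm{ch}(Q)$ be the set of the $2^n$ dyadic children of $Q\in\mathcal D$, and put $\langle f\rangle_Q=|Q|^{-1}\int_Q f\,dx$. Then there is a constant $C$, depending only on $n,p,\mathbf A,\delta$, such that the following holds. Let $S_0\in\mathcal D$, and let $b\in L^p(\mathbb R^n)$ be supported on $S_0$ with $\int b\,dx=|S_0|$ and $\|b\|_p\le\mathbf A|S_0|^{1/p}$. Let $\mathcal T'$ be the family of maximal dyadic cubes $T\subset S_0$ satisfying $$\Bigl|\int_T b\,dx\Bigr|\le\delta|T|\qquad\text{or}\qquad \int_T|b|^p\,dx\ge\delta^{-1}\mathbf A^p|T| .$$ Let $\mathcal T$ (the terminal cubes) be any family of pairwise disjoint dyadic cubes contained in $S_0$ such that every $T'\in\mathcal T'$ is contained in some $T\in\mathcal T$. For each $T\in\mathcal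 T$ let $b_T\in L^p(\mathbb R^n)$ be supported on $T$ with $\int b_T\,dx=|T|$ and $\|b_T\|_p\le\mathbf A|T|^{1/p}$. Let $\mathcal Q$ be the family of dyadic cubes that are contained in $S_0$ but in no $T\in\mathcal T$, and for $Q\in\mathcal Q$ define the twisted martingale difference $$\Delta_Q f=\sum_{Q'\in\mathrm{ch}(Q)}\Bigl[\frac{\langle f\rangle_{Q'}}{\langle b_{Q'}\rangle_{Q'}}\,b_{Q'}-\frac{\langle f\rangle_Q}{\langle b\rangle_Q}\,b\Bigr]\mathbf 1_{Q'},$$ where $b_{Q'}=b$ if $Q'\notin\mathcal T$, and $b_{Q'}$ is the given function $b_T$ with $T=Q'$ if $Q'\in\mathcal T$. Then for all scalars $\varepsilon_Q$ ($Q\in\mathcal Q$) with $|\varepsilon_Q|\le1$ and all $f\in L^p(\mathbb R^n)$, the series $\sum_{Q\in\mathcal Q}\varepsilon_Q\Delta_Qf$ converges unconditionally in $L^p(\mathbb R^n)$, and $$\Bigl\|\sum_{Q\in\mathcal Q}\varepsilon_Q\Delta_Qf\Bigr\|_p\le C\,\|f\|_p .$$ -/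

import Mathlib

open MeasureTheory Filter Topology
open scoped NNReal ENNReal

/-- An index for a cube of the standard dyadic grid of `ℝⁿ`: the cube has side length `2 ^ (-scale)`
and lower corner `2 ^ (-scale) * pos`. -/
structure DyadicCube (n : ℕ) where
  scale : ℤ
  pos : Fin n → ℤ

namespace DyadicCube

variable {n : ℕ}

/-- The half-open cube `∏ᵢ [2⁻ᵏ mᵢ, 2⁻ᵏ (mᵢ + 1))` in `ℝⁿ`. -/
def toSet (Q : DyadicCube n) : Set (Fin n → ℝ) :=
  Set.univ.pi fun i =>
    Set.Ico ((2 : ℝ) ^ (-Q.scale) * Q.pos i) ((2 : ℝ) ^ (-Q.scale) * (Q.pos i + 1))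

/-- Dyadic cubes are ordered by inclusion of the underlying sets. -/
instance : Preorder (DyadicCube n) := Preorder.lift toSet

/-- The `2ⁿ` dyadic children of `Q`, indexed by `{0,1}ⁿ`. -/
def child (Q : DyadicCube n) (e : Fin n → Fin 2) : DyadicCube n where
  scale := Q.scale + 1
  pos := fun i => 2 * Q.pos i + (e i : ℕ)

end DyadicCube

section Twisted

variable {n : ℕ} {𝕜 : Type*} [RCLike 𝕜]

/-- `b ∈ L^p` is supported on `Q`, has `∫ b = |Q|`, and `‖b‖_p ≤ A |Q|^{1/p}`. -/
structure IsAccretiveOn (p : ℝ) (A : ℝ≥0) (Q : DyadicCube n) (b : (Fin n → ℝ) → 𝕜) : Prop where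
  memLp : MemLp b (ENNReal.ofReal p) volume
  support : ∀ᵐ x, x ∉ Q.toSet → b x = 0
  integral_eq : ∫ x, b x = (volume.real Q.toSet : 𝕜)
  eLpNorm_le : eLpNorm b (ENNReal.ofReal p) volume ≤ A * volume Q.toSet ^ (1 / p)

/-- The stopping condition: `|∫_T b| ≤ δ |T|` or `∫_T |b|^p ≥ δ⁻¹ A^p |T|`. -/
def StoppingCondition (p : ℝ) (A : ℝ≥0) (δ : ℝ) (b : (Fin n → ℝ) → 𝕜) (T : DyadicCube n) : Prop :=
  ‖∫ x in T.toSet, b x‖ ≤ δ * volume.real T.toSet ∨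
    δ⁻¹ * (A : ℝ) ^ p * volume.real T.toSet ≤ ∫ x in T.toSet, ‖b x‖ ^ p

/-- The maximal dyadic cubes contained in `S₀` that meet the stopping condition. -/
def stoppingCubes (p : ℝ) (A : ℝ≥0) (δ : ℝ) (b : (Fin n → ℝ) → 𝕜) (S₀ : DyadicCube n) :
    Set (DyadicCube n) :=
  {T | Maximal (fun R => R ≤ S₀ ∧ StoppingCondition p A δ b R) T}

/-- An admissible family of terminal cubes: pairwise disjoint dyadic cubes in `S₀` such that
each maximal stopping cube is contained in one of them. -/
structure IsTerminalFamily (p : ℝ) (A : ℝ≥0) (δ : ℝ) (b : (Fin n → ℝ) → 𝕜) (S₀ : DyadicCube n)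
    (𝒯 : Set (DyadicCube n)) : Prop where
  le : ∀ T ∈ 𝒯, T ≤ S₀
  disjoint : 𝒯.PairwiseDisjoint DyadicCube.toSet
  covers : ∀ T' ∈ stoppingCubes p A δ b S₀, ∃ T ∈ 𝒯, T' ≤ T

/-- The dyadic cubes contained in `S₀` that are not contained in any terminal cube. -/
def nonterminalCubes (S₀ : DyadicCube n) (𝒯 : Set (DyadicCube n)) : Set (DyadicCube n) :=
  {Q | Q ≤ S₀ ∧ ∀ T ∈ 𝒯, ¬ Q ≤ T}

open Classical in
/-- The function `b_{Q'}` attached to a child `Q'`: it is `b_T` if `Q' = T` is terminal,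
and `b` otherwise. -/
noncomputable def childFun (b : (Fin n → ℝ) → 𝕜) (𝒯 : Set (DyadicCube n))
    (bT : DyadicCube n → (Fin n → ℝ) → 𝕜) (Q' : DyadicCube n) : (Fin n → ℝ) → 𝕜 :=
  if Q' ∈ 𝒯 then bT Q' else b

/-- The twisted martingale difference
`Δ_Q f = ∑_{Q' ∈ ch(Q)} [⟨f⟩_{Q'} / ⟨b_{Q'}⟩_{Q'} b_{Q'} - ⟨f⟩_Q / ⟨b⟩_Q b] 1_{Q'}`. -/
noncomputable def twistedDiff (b : (Fin n → ℝ) → 𝕜) (𝒯 : Set (DyadicCube n))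
    (bT : DyadicCube n → (Fin n → ℝ) → 𝕜) (Q : DyadicCube n) (f : (Fin n → ℝ) → 𝕜) :
    (Fin n → ℝ) → 𝕜 := fun x =>
  ∑ e : Fin n → Fin 2, (Q.child e).toSet.indicator (fun y =>
    (⨍ z in (Q.child e).toSet, f z) / (⨍ z in (Q.child e).toSet, childFun b 𝒯 bT (Q.child e) z)
        * childFun b 𝒯 bT (Q.child e) y
      - (⨍ z in Q.toSet, f z) / (⨍ z in Q.toSet, b z) * b y) x

end Twisted

/-!
The proof reduces the inequality to a finite, purely martingale estimate, proved with explicit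
potential functions, and then deduces unconditional convergence from the uniform convexity of `L^p`.

**Reduction to a tree.** Fix a finite family of nonterminal cubes and stop every path of dyadic
children of `S₀` at terminal cubes (`node`). Averages of `f` and `b` over the nodes form martingales
on the tree of words in `{0,1}ⁿ`. A nonterminal cube `Q` fails the stopping condition
(`not_stoppingCondition`), so `δ ≤ ‖⟨b⟩_Q‖`, and `⟨‖b‖^p⟩` is bounded on nonterminal cubes and their
children (`average_norm_rpow_node_le`). On a nonterminal node of the last generation the finite sum
of the `ε_Q Δ_Q f` equals `h b`, where the constant `h` (`twistedCoeff`) is the transform of the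
increments of `⟨f⟩ / ⟨b⟩`; on a terminal cube `T` it is a combination of `b` and `b_T` whose
coefficients are controlled by `h` and the maximal function of `f`. So the `L^p` norm of the sum is
bounded by those of `h` and of the maximal function (`average_norm_sum_rpow_le`), and `b`, which may
be unbounded, enters the rest of the argument only through its bounded averages.

**The tree estimate.** Let `F` and `G` be the running maxima of the averages of `‖f‖` and of a dual
martingale dominating `g`. The drift of the potential `‖f‖² G / F + ‖g‖² F / G + ‖b‖² F G` (plus
a multiple of `F G`) dominates, at each node, the one-step contribution to the average of `h g`: up to terms of
mean zero, this contribution is made of products of two (possibly equal) increments of `f`, `b`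
and `g`, and of one term per terminal child. Since the potential is at most a multiple of `F G`,
summing over the generations gives `‖E (h g)‖ ≤ C * E (F G)` (`exists_bilinear_bound`). For `g`
equal to `conj h * ‖h‖ ^ (p - 2)` in the last generation, Doob's maximal inequality
(`exists_doob`), also proved with a potential, and Young's inequality give the `L^p` bound of `h`
by `f` for all `1 < p < ∞` at once (`exists_transform_bound`).

**Convergence.** The bound is uniform over finite families and over multipliers. In a uniformly
convex space this forces unconditional convergence (`summable_of_bounded_of_uniformConvex`).
-/

/-! ### Averages over a homogeneous tree -/

section Tree

open scoped BigOperators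

variable {E : Type*}

/-- The largest value of `a` on the path from the root to a node. -/
def runMax (a : List E → ℝ) : List E → ℝ
  | [] => a []
  | e :: w => max (runMax a w) (a (e :: w))

lemma le_runMax (a : List E → ℝ) (w : List E) : a w ≤ runMax a w := by
  cases w with
  | nil => exact le_rfl
  | cons e w => exact le_max_right _ _

lemma runMax_le_cons (a : List E → ℝ) (e : E) (w : List E) : runMax a w ≤ runMax a (e :: w) :=
  le_max_left _ _

lemma runMax_nonneg {a : List E → ℝ} (ha : ∀ w, 0 ≤ a w) (w : List E) : 0 ≤ runMax a w :=
  (ha w).trans (le_runMax a w)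

variable [Fintype E]

/-- The average of `u` over the descendants of the node `w`, `N` generations below it, in the tree
of words over the alphabet `E`; the children of `w` are the words `e :: w`. -/
noncomputable def iterAvg {M : Type*} [AddCommMonoid M] [Module ℚ≥0 M] (u : List E → M) :
    ℕ → List E → M
  | 0, w => u w
  | N + 1, w => 𝔼 e, iterAvg u N (e :: w)

lemma iterAvg_mono {u v : List E → ℝ} (N : ℕ) (w : List E)
    (h : ∀ w' : List E, w'.length = w.length + N → u w' ≤ v w') :
    iterAvg u N w ≤ iterAvg v N w := by
  induction N generalizing w with
  | zero => exact h w rfl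
  | succ N ih =>
    refine Finset.expect_le_expect fun e _ => ih _ fun w' hw' => h w' ?_
    rw [hw', List.length_cons]; ring

lemma iterAvg_congr {M : Type*} [AddCommMonoid M] [Module ℚ≥0 M] {u v : List E → M} (N : ℕ)
    (w : List E) (h : ∀ w' : List E, w'.length = w.length + N → u w' = v w') :
    iterAvg u N w = iterAvg v N w := by
  induction N generalizing w with
  | zero => exact h w rfl
  | succ N ih =>
    refine Finset.expect_congr rfl fun e _ => ih _ fun w' hw' => h w' ?_
    rw [hw', List.length_cons]; ring

lemma iterAvg_of_martingale {M : Type*} [AddCommMonoid M] [Module ℚ≥0 M] {u : List E → M} (N : ℕ)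
    (w : List E) (h : ∀ w' : List E, w'.length < w.length + N → 𝔼 e, u (e :: w') = u w') :
    iterAvg u N w = u w := by
  induction N generalizing w with
  | zero => rfl
  | succ N ih =>
    rw [← h w (by omega)]
    refine Finset.expect_congr rfl fun e _ => ih _ fun w' hw' => h w' ?_
    rw [List.length_cons] at hw'; omega

lemma iterAvg_add {M : Type*} [AddCommMonoid M] [Module ℚ≥0 M] (u v : List E → M) (N : ℕ)
    (w : List E) : iterAvg (fun w => u w + v w) N w = iterAvg u N w + iterAvg v N w := by
  induction N generalizing w with
  | zero => rfl
  | succ N ih => simp only [iterAvg, ih, Finset.expect_add_distrib]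

lemma iterAvg_const_mul (c : ℝ) (u : List E → ℝ) (N : ℕ) (w : List E) :
    iterAvg (fun w => c * u w) N w = c * iterAvg u N w := by
  induction N generalizing w with
  | zero => rfl
  | succ N ih => simp only [iterAvg, ih, Finset.mul_expect]

lemma iterAvg_nonneg {u : List E → ℝ} (hu : ∀ w, 0 ≤ u w) (N : ℕ) (w : List E) :
    0 ≤ iterAvg u N w := by
  induction N generalizing w with
  | zero => exact hu w
  | succ N ih => exact Finset.expect_nonneg fun e _ => ih _

lemma ofReal_iterAvg {𝕜 : Type*} [RCLike 𝕜] (u : List E → ℝ) (N : ℕ) (w : List E) :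
    iterAvg (fun w => (u w : 𝕜)) N w = ((iterAvg u N w : ℝ) : 𝕜) := by
  induction N generalizing w with
  | zero => rfl
  | succ N ih => simp only [iterAvg, ih, RCLike.ofReal_expect]

lemma norm_iterAvg_le {𝕜 : Type*} [RCLike 𝕜] (u : List E → 𝕜) (N : ℕ) (w : List E) :
    ‖iterAvg u N w‖ ≤ iterAvg (fun w => ‖u w‖) N w := by
  induction N generalizing w with
  | zero => exact le_rfl
  | succ N ih =>
    exact (RCLike.norm_expect_le (K := 𝕜)).trans (Finset.expect_le_expect fun e _ => ih _)

/-- If the drift of `X` is dominated by the drift of a real potential `V` at every node, then the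
total change of `X` over `N` generations is dominated by that of `V`. -/
lemma norm_iterAvg_sub_le {𝕜 : Type*} [RCLike 𝕜] {X : List E → 𝕜} {V : List E → ℝ} (N : ℕ)
    (w : List E)
    (h : ∀ w' : List E, w'.length < w.length + N →
      ‖𝔼 e, X (e :: w') - X w'‖ ≤ 𝔼 e, V (e :: w') - V w') :
    ‖iterAvg X N w - X w‖ ≤ iterAvg V N w - V w := by
  induction N generalizing w with
  | zero => simp [iterAvg]
  | succ N ih =>
    have h1 : iterAvg X (N + 1) w - X w =
        𝔼 e, (iterAvg X N (e :: w) - X (e :: w)) + (𝔼 e, X (e :: w) - X w) := by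
      rw [Finset.expect_sub_distrib]; simp [iterAvg]
    have h2 : iterAvg V (N + 1) w - V w =
        𝔼 e, (iterAvg V N (e :: w) - V (e :: w)) + (𝔼 e, V (e :: w) - V w) := by
      rw [Finset.expect_sub_distrib]; simp [iterAvg]
    rw [h1, h2]
    refine (norm_add_le _ _).trans (add_le_add ?_ (h w (by omega)))
    refine (RCLike.norm_expect_le (K := 𝕜)).trans (Finset.expect_le_expect fun e _ => ih _ ?_)
    intro w' hw'
    refine h w' ?_
    rw [List.length_cons] at hw'; omega

lemma le_iterAvg_of_submartingale {V : List E → ℝ} (N : ℕ) (w : List E)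
    (h : ∀ w' : List E, w'.length < w.length + N → V w' ≤ 𝔼 e, V (e :: w')) :
    V w ≤ iterAvg V N w := by
  induction N generalizing w with
  | zero => exact le_rfl
  | succ N ih =>
    refine (h w (by omega)).trans (Finset.expect_le_expect fun e _ => ih _ fun w' hw' => h w' ?_)
    rw [List.length_cons] at hw'; omega

/-- The running maximum of a nonnegative martingale grows by a factor of at most the number of
children per generation. -/
lemma runMax_cons_le [Nonempty E] {a : List E → ℝ} (ha : ∀ w, 0 ≤ a w) (w : List E)
    (h : 𝔼 e, a (e :: w) = a w) (e : E) :
    runMax a (e :: w) ≤ Fintype.card E * runMax a w := by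
  have h1 : (1 : ℝ) ≤ Fintype.card E := by exact_mod_cast Fintype.card_pos
  refine max_le (le_mul_of_one_le_left (runMax_nonneg ha w) h1) ?_
  calc a (e :: w) ≤ ∑ e, a (e :: w) :=
        Finset.single_le_sum (f := fun e => a (e :: w)) (fun e _ => ha _) (Finset.mem_univ e)
    _ = Fintype.card E * a w := by rw [← h, Fintype.card_mul_expect]
    _ ≤ _ := by gcongr; exact le_runMax a w

/-- Young's inequality with a small constant in front of the first term. -/
lemma exists_young {p q : ℝ} (hpq : p.HolderConjugate q) {η : ℝ} (hη : 0 < η) :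
    ∃ C : ℝ, 0 ≤ C ∧ ∀ x y : ℝ, 0 ≤ x → 0 ≤ y → x * y ≤ η * x ^ p + C * y ^ q := by
  have hp := hpq.pos
  have hl : 0 < η ^ (1 / p) := by positivity
  refine ⟨((η ^ (1 / p)) ^ q)⁻¹, by positivity, fun x y hx hy => ?_⟩
  have h := Real.young_inequality_of_nonneg (a := η ^ (1 / p) * x) (b := y / η ^ (1 / p))
    (by positivity) (by positivity) hpq
  rw [Real.mul_rpow hl.le hx, Real.div_rpow hy hl.le, ← Real.rpow_mul hη.le,
    one_div_mul_cancel hp.ne', Real.rpow_one] at h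
  calc x * y = η ^ (1 / p) * x * (y / η ^ (1 / p)) := by field_simp
    _ ≤ _ := h
    _ ≤ η * x ^ p + y ^ q / (η ^ (1 / p)) ^ q :=
        add_le_add (div_le_self (by positivity) hpq.lt.le)
          (div_le_self (by positivity) hpq.symm.lt.le)
    _ = _ := by ring

/-- **Doob's maximal inequality** on the tree. For `F = runMax a` the function
`q * F ^ (p - 1) * a - F ^ p` is a submartingale that is nonnegative at the root. -/
lemma exists_doob [Nonempty E] {p : ℝ} (hp : 1 < p) :
    ∃ C : ℝ, 0 ≤ C ∧ ∀ (N : ℕ) (a : List E → ℝ),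
      (∀ w, 0 ≤ a w) →
      (∀ w, w.length < N → 𝔼 e, a (e :: w) = a w) →
      iterAvg (fun w => runMax a w ^ p) N [] ≤ C * iterAvg (fun w => a w ^ p) N [] := by
  obtain ⟨q, hpq⟩ : ∃ q, p.HolderConjugate q := ⟨_, Real.HolderConjugate.conjExponent hp⟩
  have hq := hpq.symm.lt
  obtain ⟨C, hC, hY⟩ := exists_young hpq.symm (η := 1 / (2 * q)) (by positivity)
  refine ⟨2 * (q * C), by positivity, fun N a ha hm => ?_⟩
  set F := runMax a with hF
  have hF0 : ∀ w, 0 ≤ F w := runMax_nonneg ha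
  have hpow : ∀ x : ℝ, 0 ≤ x → x ^ (p - 1) * x = x ^ p := fun x hx => by
    rw [← Real.rpow_add_one' hx (by linarith)]; ring_nf
  have hconj : ∀ x : ℝ, 0 ≤ x → (x ^ (p - 1)) ^ q = x ^ p := fun x hx => by
    rw [← Real.rpow_mul hx, hpq.sub_one_mul_conj]
  have hqp : q / p = q - 1 := by
    have := hpq.symm.sub_one_mul_conj
    have := hpq.pos; field_simp; linarith
  set Ψ : List E → ℝ := fun w => q * (F w ^ (p - 1) * a w) - F w ^ p with hΨ
  have hstep : ∀ w e, q * (F w ^ (p - 1) * a (e :: w)) - F w ^ p ≤ Ψ (e :: w) := by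
    intro w e
    rcases le_total (a (e :: w)) (F w) with h | h
    · have : F (e :: w) = F w := max_eq_left h
      simp [hΨ, this]
    · have hFe : F (e :: w) = a (e :: w) := max_eq_right h
      simp only [hΨ, hFe, hpow _ (ha _)]
      have := Real.young_inequality_of_nonneg (a := F w ^ (p - 1)) (b := a (e :: w))
        (Real.rpow_nonneg (hF0 w) _) (ha _) hpq.symm
      rw [hconj _ (hF0 w)] at this
      have h2 := mul_le_mul_of_nonneg_left this hpq.symm.pos.le
      have h3 : q * (F w ^ p / q + a (e :: w) ^ p / p)
          = F w ^ p + (q / p) * a (e :: w) ^ p := by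
        have := hpq.symm.pos.ne'; field_simp
      rw [h3, hqp] at h2
      linarith
  have hsub : Ψ [] ≤ iterAvg Ψ N [] := by
    refine le_iterAvg_of_submartingale N [] fun w hw => ?_
    have h1 := hm w (by simpa using hw)
    calc Ψ w = 𝔼 e, (q * (F w ^ (p - 1) * a (e :: w)) - F w ^ p) := by
          rw [Finset.expect_sub_distrib, ← Finset.mul_expect, ← Finset.mul_expect, h1,
            Fintype.expect_const]
      _ ≤ _ := Finset.expect_le_expect fun e _ => hstep w e
  have h0 : 0 ≤ Ψ [] := by
    have : F [] = a [] := rfl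
    simp only [hΨ, this, hpow _ (ha _)]
    nlinarith [Real.rpow_nonneg (ha []) p]
  have hle : iterAvg Ψ N [] ≤
      iterAvg (fun w => q * C * a w ^ p + (-(1 / 2)) * F w ^ p) N [] := by
    refine iterAvg_mono N [] fun w _ => ?_
    have := hY (F w ^ (p - 1)) (a w) (Real.rpow_nonneg (hF0 w) _) (ha _)
    rw [hconj _ (hF0 w)] at this
    have h2 := mul_le_mul_of_nonneg_left this hpq.symm.pos.le
    have h3 : q * (1 / (2 * q) * F w ^ p + C * a w ^ p) = 1 / 2 * F w ^ p + q * C * a w ^ p := by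
      have := hpq.symm.pos.ne'; field_simp
    simp only [hΨ]
    linarith
  rw [iterAvg_add, iterAvg_const_mul, iterAvg_const_mul] at hle
  linarith

end Tree

/-! ### The twisted martingale transform on the tree -/

section Transform

open scoped BigOperators

variable {E : Type*} [Fintype E] [Nonempty E] {𝕜 : Type*} [RCLike 𝕜]

lemma expect_norm_sq_eq {u : E → 𝕜} {c : 𝕜} (h : 𝔼 e, u e = c) :
    𝔼 e, ‖u e‖ ^ 2 = ‖c‖ ^ 2 + 𝔼 e, ‖u e - c‖ ^ 2 := by
  have h1 : ∀ e, ‖u e - c‖ ^ 2 = ‖u e‖ ^ 2 - 2 * RCLike.re (inner 𝕜 (u e) c) + ‖c‖ ^ 2 :=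
    fun e => norm_sub_sq (𝕜 := 𝕜) _ _
  have h2 : 𝔼 e, RCLike.re (inner 𝕜 (u e) c) = ‖c‖ ^ 2 := by
    have hs : ∑ e, u e = (Fintype.card E : 𝕜) * c := by rw [← h, Fintype.card_mul_expect]
    rw [Fintype.expect_eq_sum_div_card, ← map_sum, ← sum_inner, hs, ← smul_eq_mul,
      inner_smul_left, map_natCast, ← RCLike.ofReal_natCast, RCLike.re_ofReal_mul,
      inner_self_eq_norm_sq, mul_div_cancel_left₀]
    exact_mod_cast Fintype.card_ne_zero
  simp only [h1, Finset.expect_add_distrib, Finset.expect_sub_distrib, ← Finset.mul_expect, h2,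
    Fintype.expect_const]
  ring

/-- The function `y ^ 2 * (G / F)` increases along a path up to a multiple of the increase of
`F * G`. -/
lemma sq_mul_div_add_le {D F G F' G' y : ℝ} (hF : 0 ≤ F) (hG : 0 ≤ G) (hFF : F ≤ F')
    (hFD : F' ≤ D * F) (hGG : G ≤ G') (hy : 0 ≤ y) (hyF : y ≤ F') (hD : 0 ≤ D) :
    y ^ 2 * (G / F) + D * (F * G) ≤ y ^ 2 * (G' / F') + D * (F' * G') := by
  rcases hF.eq_or_lt with rfl | hF
  · have : F' = 0 := le_antisymm (by simpa using hFD) hFF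
    subst this
    simp
  have hF' : 0 < F' := hF.trans_le hFF
  have h1 : y ^ 2 * (G / F') ≤ y ^ 2 * (G' / F') := by gcongr
  have h2 : y ^ 2 * (G / F) - y ^ 2 * (G / F') = y ^ 2 * (G * (F' - F)) / (F * F') := by
    field_simp
  have h3 : y ^ 2 * (G * (F' - F)) / (F * F') ≤ D * (G * (F' - F)) := by
    rw [div_le_iff₀ (by positivity)]
    have h4 : y ^ 2 ≤ D * (F * F') := by nlinarith
    have h5 : 0 ≤ G * (F' - F) := mul_nonneg hG (by linarith)
    nlinarith
  have h6 : D * (F' * G) ≤ D * (F' * G') := by gcongr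
  nlinarith

/-- The three products occurring in the bilinear form are dominated by the drift terms. The
hypotheses on `F = 0` and `G = 0` make the junk values of the divisions harmless. -/
lemma products_le_drift {F G α β ζ : ℝ} (hF : 0 ≤ F) (hG : 0 ≤ G) (hα : F = 0 → α = 0)
    (hζ : G = 0 → ζ = 0) :
    α * ζ ≤ α ^ 2 * (G / F) + ζ ^ 2 * (F / G) + β ^ 2 * (F * G) ∧
    F * β * ζ ≤ α ^ 2 * (G / F) + ζ ^ 2 * (F / G) + β ^ 2 * (F * G) ∧
    α * β * G ≤ α ^ 2 * (G / F) + ζ ^ 2 * (F / G) + β ^ 2 * (F * G) ∧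
    0 ≤ α ^ 2 * (G / F) + ζ ^ 2 * (F / G) := by
  obtain ⟨s, rfl⟩ : ∃ s, α = s * F := by
    rcases eq_or_ne F 0 with h | h
    · exact ⟨0, by simp [hα h]⟩
    · exact ⟨α / F, by field_simp⟩
  obtain ⟨r, rfl⟩ : ∃ r, ζ = r * G := by
    rcases eq_or_ne G 0 with h | h
    · exact ⟨0, by simp [hζ h]⟩
    · exact ⟨ζ / G, by field_simp⟩
  have h1 : (s * F) ^ 2 * (G / F) = s ^ 2 * (F * G) := by
    rcases eq_or_ne F 0 with h | h
    · simp [h]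
    · field_simp
  have h2 : (r * G) ^ 2 * (F / G) = r ^ 2 * (F * G) := by
    rcases eq_or_ne G 0 with h | h
    · simp [h]
    · field_simp
  have h := mul_nonneg hF hG
  rw [h1, h2]
  refine ⟨?_, ?_, ?_, by positivity⟩
  · have : s * r ≤ s ^ 2 + r ^ 2 + β ^ 2 := by
      nlinarith [sq_nonneg (s - r), sq_nonneg s, sq_nonneg r, sq_nonneg β]
    nlinarith [mul_le_mul_of_nonneg_right this h]
  · have : β * r ≤ s ^ 2 + r ^ 2 + β ^ 2 := by
      nlinarith [sq_nonneg (β - r), sq_nonneg s, sq_nonneg r, sq_nonneg β]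
    nlinarith [mul_le_mul_of_nonneg_right this h]
  · have : s * β ≤ s ^ 2 + r ^ 2 + β ^ 2 := by
      nlinarith [sq_nonneg (s - β), sq_nonneg s, sq_nonneg r, sq_nonneg β]
    nlinarith [mul_le_mul_of_nonneg_right this h]

lemma norm_div_sub_div_le {δ F : ℝ} (hδ : 0 < δ) {f f' b b' c : 𝕜} (hb : δ ≤ ‖b‖) (hc : δ ≤ ‖c‖)
    (hf : ‖f‖ ≤ F) :
    ‖((f' - f) - f / b * (b' - b)) / c‖ ≤ δ⁻¹ * ‖f' - f‖ + δ⁻¹ ^ 2 * (F * ‖b' - b‖) := by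
  have hF : 0 ≤ F := (norm_nonneg _).trans hf
  rw [norm_div, div_eq_inv_mul]
  have h1 : ‖c‖⁻¹ ≤ δ⁻¹ := inv_anti₀ hδ hc
  have h2 : ‖f / b‖ ≤ δ⁻¹ * F := by
    rw [norm_div, div_eq_inv_mul]
    exact mul_le_mul (inv_anti₀ hδ hb) hf (norm_nonneg _) (by positivity)
  have h3 : ‖(f' - f) - f / b * (b' - b)‖ ≤ ‖f' - f‖ + δ⁻¹ * F * ‖b' - b‖ := by
    refine (norm_sub_le _ _).trans ?_
    rw [norm_mul]
    gcongr
  calc ‖c‖⁻¹ * ‖(f' - f) - f / b * (b' - b)‖ ≤ δ⁻¹ * (‖f' - f‖ + δ⁻¹ * F * ‖b' - b‖) := by gcongr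
    _ = _ := by ring

/-- The one-step estimate of the bilinear form at a good node. The part of the increment that is
linear in `f' - f` and `b' - b` has mean zero over all children, so it may be paired with `g' - g`;
the remainder is quadratic, except at bad children. -/
lemma norm_expect_increment_mul_le {δ B D : ℝ} (hδ : 0 < δ) (hB : 0 ≤ B) (hD : 1 ≤ D)
    {f b g ε : 𝕜} {f' b' g' d : E → 𝕜} {F G : ℝ} {F' G' : E → ℝ} {good : E → Prop}
    [DecidablePred good]
    (hf : 𝔼 e, f' e = f) (hb : 𝔼 e, b' e = b) (hfF : ‖f‖ ≤ F) (hgG : ‖g‖ ≤ G)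
    (hfF' : ∀ e, ‖f' e‖ ≤ F' e) (hgG' : ∀ e, ‖g' e‖ ≤ G' e) (hbδ : δ ≤ ‖b‖) (hbB : ‖b‖ ≤ B)
    (hbB' : ∀ e, ‖b' e‖ ≤ B) (hbδ' : ∀ e, good e → δ ≤ ‖b' e‖) (hε : ‖ε‖ ≤ 1)
    (hFF : ∀ e, F ≤ F' e) (hFD : ∀ e, F' e ≤ D * F) (hGD : ∀ e, G' e ≤ D * G)
    (hd : ∀ e, d e = if good e then ε * (f' e / b' e - f / b) else 0) :
    ‖𝔼 e, d e * g' e‖ ≤ (δ⁻¹ + δ⁻¹ ^ 2 + 2 * D * (δ⁻¹ ^ 2 + δ⁻¹ ^ 3) + 2 * δ⁻¹ + 2 * δ⁻¹ ^ 2 * B) *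
      𝔼 e, (‖f' e - f‖ ^ 2 * (G / F) + ‖g' e - g‖ ^ 2 * (F / G) + ‖b' e - b‖ ^ 2 * (F * G)
        + if good e then 0 else F' e * G' e) := by
  have hF : 0 ≤ F := (norm_nonneg _).trans hfF
  have hG : 0 ≤ G := (norm_nonneg _).trans hgG
  have hb0 : b ≠ 0 := norm_pos_iff.1 (hδ.trans_le hbδ)
  set x : E → 𝕜 := fun e => ((f' e - f) - f / b * (b' e - b)) / b with hx
  have hx0 : 𝔼 e, x e = 0 := by
    simp only [hx]
    rw [← Finset.expect_div, Finset.expect_sub_distrib, ← Finset.mul_expect,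
      Finset.expect_sub_distrib, Finset.expect_sub_distrib, hf, hb]
    simp
  have hsplit : 𝔼 e, d e * g' e = 𝔼 e, (ε * x e * (g' e - g) + (d e - ε * x e) * g' e) := by
    have h1 : ∀ e, ε * x e * (g' e - g) + (d e - ε * x e) * g' e = d e * g' e - x e * (ε * g) :=
      fun e => by ring
    simp only [h1]
    rw [Finset.expect_sub_distrib, ← Finset.expect_mul, hx0]
    simp
  rw [hsplit, Finset.mul_expect]
  refine (RCLike.norm_expect_le (K := 𝕜)).trans (Finset.expect_le_expect fun e _ => ?_)
  have hα : F = 0 → ‖f' e - f‖ = 0 := by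
    intro h
    have h1 : F' e = 0 := le_antisymm (by simpa [h] using hFD e) (h ▸ hFF e)
    have h2 : f' e = 0 := norm_le_zero_iff.1 (h1 ▸ hfF' e)
    have h3 : f = 0 := norm_le_zero_iff.1 (h ▸ hfF)
    simp [h2, h3]
  have hζ : G = 0 → ‖g' e - g‖ = 0 := by
    intro h
    have h2 : g' e = 0 := norm_le_zero_iff.1 ((hgG' e).trans (by simpa [h] using hGD e))
    have h3 : g = 0 := norm_le_zero_iff.1 (h ▸ hgG)
    simp [h2, h3]
  obtain ⟨p1, p2, p3, p4⟩ := products_le_drift (β := ‖b' e - b‖) hF hG hα hζ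
  have hxn : ‖x e‖ ≤ δ⁻¹ * ‖f' e - f‖ + δ⁻¹ ^ 2 * (F * ‖b' e - b‖) :=
    norm_div_sub_div_le hδ hbδ hbδ hfF
  have hi : 0 < δ⁻¹ := by positivity
  set S := ‖f' e - f‖ ^ 2 * (G / F) + ‖g' e - g‖ ^ 2 * (F / G) + ‖b' e - b‖ ^ 2 * (F * G) with hS
  have hb2 : ‖b' e - b‖ ^ 2 * (F * G) ≤ S := by rw [hS]; linarith
  have hS0 : 0 ≤ S := by rw [hS]; positivity
  have hfirst : ‖ε * x e * (g' e - g)‖ ≤ (δ⁻¹ + δ⁻¹ ^ 2) * S := by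
    rw [norm_mul, norm_mul]
    calc ‖ε‖ * ‖x e‖ * ‖g' e - g‖
        ≤ 1 * (δ⁻¹ * ‖f' e - f‖ + δ⁻¹ ^ 2 * (F * ‖b' e - b‖)) * ‖g' e - g‖ := by gcongr
      _ = δ⁻¹ * (‖f' e - f‖ * ‖g' e - g‖) + δ⁻¹ ^ 2 * (F * ‖b' e - b‖ * ‖g' e - g‖) := by ring
      _ ≤ δ⁻¹ * S + δ⁻¹ ^ 2 * S := by gcongr
      _ = _ := by ring
  have hsecond : ‖(d e - ε * x e) * g' e‖ ≤
      (2 * D * (δ⁻¹ ^ 2 + δ⁻¹ ^ 3)) * S +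
        (2 * δ⁻¹ + 2 * δ⁻¹ ^ 2 * B) * (if good e then 0 else F' e * G' e) := by
    rw [norm_mul]
    by_cases hge : good e
    · have hb'0 : b' e ≠ 0 := norm_pos_iff.1 (hδ.trans_le (hbδ' e hge))
      have hde : d e - ε * x e = -(ε * ((b' e - b) / b *
          (((f' e - f) - f / b * (b' e - b)) / b' e))) := by
        rw [hd e, if_pos hge, hx]
        field_simp
        ring
      have hn : ‖d e - ε * x e‖ ≤
          δ⁻¹ * ‖b' e - b‖ * (δ⁻¹ * ‖f' e - f‖ + δ⁻¹ ^ 2 * (F * ‖b' e - b‖)) := by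
        rw [hde, norm_neg, norm_mul, norm_mul, norm_div (b' e - b), div_eq_inv_mul]
        have h1 : ‖b‖⁻¹ ≤ δ⁻¹ := inv_anti₀ hδ hbδ
        have h2 := norm_div_sub_div_le (f' := f' e) (b' := b' e) hδ hbδ (hbδ' e hge) hfF
        calc _ ≤ 1 * (δ⁻¹ * ‖b' e - b‖ *
              (δ⁻¹ * ‖f' e - f‖ + δ⁻¹ ^ 2 * (F * ‖b' e - b‖))) := by gcongr
          _ = _ := one_mul _
      rw [if_pos hge, mul_zero, add_zero]
      calc ‖d e - ε * x e‖ * ‖g' e‖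
          ≤ δ⁻¹ * ‖b' e - b‖ * (δ⁻¹ * ‖f' e - f‖ + δ⁻¹ ^ 2 * (F * ‖b' e - b‖)) * (D * G) := by
            gcongr
            exact (hgG' e).trans (hGD e)
        _ = D * (δ⁻¹ ^ 2 * (‖f' e - f‖ * ‖b' e - b‖ * G)
              + δ⁻¹ ^ 3 * (‖b' e - b‖ ^ 2 * (F * G))) := by ring
        _ ≤ D * (δ⁻¹ ^ 2 * S + δ⁻¹ ^ 3 * S) := by gcongr
        _ ≤ _ := by
          have : 0 ≤ D * (δ⁻¹ ^ 2 * S + δ⁻¹ ^ 3 * S) := by positivity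
          nlinarith
    · have hF'0 : 0 ≤ F' e := hF.trans (hFF e)
      rw [if_neg hge, hd e, if_neg hge, zero_sub, norm_neg, norm_mul]
      have h1 : ‖f' e - f‖ ≤ 2 * F' e := by
        have := norm_sub_le (f' e) f
        linarith [hfF' e, hFF e]
      have h2 : ‖b' e - b‖ ≤ 2 * B := by
        have := norm_sub_le (b' e) b
        linarith [hbB' e]
      calc ‖ε‖ * ‖x e‖ * ‖g' e‖
          ≤ 1 * (δ⁻¹ * (2 * F' e) + δ⁻¹ ^ 2 * (F' e * (2 * B))) * G' e := by
            gcongr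
            · refine hxn.trans ?_
              gcongr
              exact hFF e
            · exact hgG' e
        _ = (2 * δ⁻¹ + 2 * δ⁻¹ ^ 2 * B) * (F' e * G' e) := by ring
        _ ≤ _ := le_add_of_nonneg_left (by positivity)
  have hbad : 0 ≤ (if good e then 0 else F' e * G' e) := by
    split_ifs
    · exact le_rfl
    · exact mul_nonneg (hF.trans (hFF e)) ((norm_nonneg _).trans (hgG' e))
  refine (norm_add_le _ _).trans ((add_le_add hfirst hsecond).trans ?_)
  set Z : ℝ := if good e then 0 else F' e * G' e
  have e1 : 0 ≤ (2 * δ⁻¹ + 2 * δ⁻¹ ^ 2 * B) * S := by positivity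
  have e2 : 0 ≤ (δ⁻¹ + δ⁻¹ ^ 2 + 2 * D * (δ⁻¹ ^ 2 + δ⁻¹ ^ 3)) * Z := by positivity
  linarith

end Transform

section TransformBound

open scoped BigOperators

variable {E : Type*} [Fintype E] {𝕜 : Type*} [RCLike 𝕜]

/-- The potential `‖f‖² G / F + ‖g‖² F / G + ‖b‖² F G` (with corrections that are multiples of
`F G`), where `F` and `G` are running maxima. Its drift controls the bilinear form of the twisted
transform, while the potential itself is bounded by a multiple of `F G`. -/
noncomputable def bilinearPotential (f b g : List E → 𝕜) (F G : List E → ℝ)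
    (good : List E → Prop) [DecidablePred good] (w : List E) : ℝ :=
  (‖f w‖ ^ 2 * (G w / F w) + Fintype.card E * (F w * G w)) +
    (‖g w‖ ^ 2 * (F w / G w) + Fintype.card E * (G w * F w)) +
    ‖b w‖ ^ 2 * (F w * G w) + if good w then 0 else F w * G w

lemma drift_le_bilinearPotential [Nonempty E] {f b g : List E → 𝕜} {a γ : List E → ℝ}
    {good : List E → Prop} [DecidablePred good] (w : List E)
    (hf : 𝔼 e, f (e :: w) = f w) (hb : 𝔼 e, b (e :: w) = b w) (hg : 𝔼 e, g (e :: w) = g w)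
    (ha : 𝔼 e, a (e :: w) = a w) (hγ : 𝔼 e, γ (e :: w) = γ w)
    (hfa : ∀ w, ‖f w‖ ≤ a w) (hgγ : ∀ w, ‖g w‖ ≤ γ w)
    (hgood : ∀ e, good (e :: w) → good w) :
    𝔼 e, (‖f (e :: w) - f w‖ ^ 2 * (runMax γ w / runMax a w) +
        ‖g (e :: w) - g w‖ ^ 2 * (runMax a w / runMax γ w) +
        ‖b (e :: w) - b w‖ ^ 2 * (runMax a w * runMax γ w) +
        if good (e :: w) then 0 else
          if good w then runMax a (e :: w) * runMax γ (e :: w) else 0) ≤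
      𝔼 e, bilinearPotential f b g (runMax a) (runMax γ) good (e :: w) -
        bilinearPotential f b g (runMax a) (runMax γ) good w := by
  have ha0 : ∀ w, 0 ≤ a w := fun w => (norm_nonneg _).trans (hfa w)
  have hγ0 : ∀ w, 0 ≤ γ w := fun w => (norm_nonneg _).trans (hgγ w)
  set F := runMax a
  set G := runMax γ
  have hF : ∀ w, 0 ≤ F w := runMax_nonneg ha0
  have hG : ∀ w, 0 ≤ G w := runMax_nonneg hγ0
  have hFF : ∀ e, F w ≤ F (e :: w) := fun e => runMax_le_cons a e w
  have hGG : ∀ e, G w ≤ G (e :: w) := fun e => runMax_le_cons γ e w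
  have key : ∀ e, ‖f (e :: w)‖ ^ 2 * (G w / F w) + ‖g (e :: w)‖ ^ 2 * (F w / G w) +
      ‖b (e :: w)‖ ^ 2 * (F w * G w) + (2 * (Fintype.card E * (F w * G w)) +
      if good w then 0 else F w * G w) +
      (if good (e :: w) then 0 else if good w then F (e :: w) * G (e :: w) else 0) ≤
      bilinearPotential f b g F G good (e :: w) := by
    intro e
    have h1 := sq_mul_div_add_le (y := ‖f (e :: w)‖) (hF w) (hG w) (hFF e)
      (runMax_cons_le ha0 w ha e) (hGG e) (norm_nonneg _)
      ((hfa _).trans (le_runMax a _)) (Nat.cast_nonneg _)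
    have h2 := sq_mul_div_add_le (y := ‖g (e :: w)‖) (hG w) (hF w) (hGG e)
      (runMax_cons_le hγ0 w hγ e) (hFF e) (norm_nonneg _)
      ((hgγ _).trans (le_runMax γ _)) (Nat.cast_nonneg _)
    have hFG : F w * G w ≤ F (e :: w) * G (e :: w) :=
      mul_le_mul (hFF e) (hGG e) (hG w) (hF _)
    have h3 : ‖b (e :: w)‖ ^ 2 * (F w * G w) ≤ ‖b (e :: w)‖ ^ 2 * (F (e :: w) * G (e :: w)) :=
      mul_le_mul_of_nonneg_left hFG (by positivity)
    have h4 : (if good w then 0 else F w * G w) +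
        (if good (e :: w) then 0 else if good w then F (e :: w) * G (e :: w) else 0) ≤
        if good (e :: w) then 0 else F (e :: w) * G (e :: w) := by
      by_cases hw : good w <;> by_cases hew : good (e :: w)
      · simp [hw, hew]
      · simp [hw, hew]
      · exact absurd (hgood e hew) hw
      · simpa [hw, hew] using hFG
    unfold bilinearPotential
    linarith [mul_comm (F w) (G w)]
  refine le_sub_iff_add_le.2 (le_trans (le_of_eq ?_) (Finset.expect_le_expect fun e _ => key e))
  simp only [Finset.expect_add_distrib, Fintype.expect_const, ← Finset.expect_mul]
  rw [expect_norm_sq_eq hf, expect_norm_sq_eq hg, expect_norm_sq_eq hb]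
  unfold bilinearPotential
  ring

lemma bilinearPotential_le {f b g : List E → 𝕜} {F G : List E → ℝ} {good : List E → Prop}
    [DecidablePred good] {B : ℝ} {w : List E} (hf : ‖f w‖ ≤ F w) (hg : ‖g w‖ ≤ G w)
    (hb : ‖b w‖ ≤ B) :
    bilinearPotential f b g F G good w ≤ (2 * Fintype.card E + B ^ 2 + 3) * (F w * G w) := by
  have hF : 0 ≤ F w := (norm_nonneg _).trans hf
  have hG : 0 ≤ G w := (norm_nonneg _).trans hg
  have aux : ∀ {x y z : ℝ}, 0 ≤ x → x ≤ y → 0 ≤ z → x ^ 2 * (z / y) ≤ y * z := by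
    intro x y z hx hxy hz
    rcases eq_or_ne y 0 with h | h
    · simp [h]
    · calc x ^ 2 * (z / y) ≤ y ^ 2 * (z / y) := by
            have := hx.trans hxy
            gcongr
        _ = y * z := by field_simp
  have h1 := aux (norm_nonneg _) hf hG
  have h2 := aux (norm_nonneg _) hg hF
  have h3 : ‖b w‖ ^ 2 * (F w * G w) ≤ B ^ 2 * (F w * G w) := by gcongr
  have h4 : (if good w then 0 else F w * G w) ≤ F w * G w := by
    split_ifs
    · positivity
    · exact le_rfl
  unfold bilinearPotential
  nlinarith

lemma bilinearPotential_nonneg {f b g : List E → 𝕜} {F G : List E → ℝ} {good : List E → Prop}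
    [DecidablePred good] {w : List E} (hF : 0 ≤ F w) (hG : 0 ≤ G w) :
    0 ≤ bilinearPotential f b g F G good w := by
  unfold bilinearPotential
  have : 0 ≤ (if good w then 0 else F w * G w) := by split_ifs <;> positivity
  positivity

/-- The twisted martingale transform `h` is controlled, in duality with a martingale `g`, by the
product of the running maxima. -/
lemma exists_bilinear_bound [Nonempty E] {δ B : ℝ} (hδ : 0 < δ) (hB : 0 ≤ B) :
    ∃ C : ℝ, 0 ≤ C ∧ ∀ (N : ℕ) (f b g ε h : List E → 𝕜) (a γ : List E → ℝ)
      (good : List E → Prop) [DecidablePred good],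
      (∀ w, w.length < N → 𝔼 e, f (e :: w) = f w) →
      (∀ w, w.length < N → 𝔼 e, b (e :: w) = b w) →
      (∀ w, w.length < N → 𝔼 e, g (e :: w) = g w) →
      (∀ w, w.length < N → 𝔼 e, a (e :: w) = a w) →
      (∀ w, w.length < N → 𝔼 e, γ (e :: w) = γ w) →
      (∀ w, ‖f w‖ ≤ a w) → (∀ w, ‖g w‖ ≤ γ w) → (∀ w, ‖b w‖ ≤ B) →
      (∀ w, good w → δ ≤ ‖b w‖) → (∀ e w, good (e :: w) → good w) → (∀ w, ‖ε w‖ ≤ 1) →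
      h [] = 0 →
      (∀ e w, h (e :: w) = h w +
        if good (e :: w) then ε w * (f (e :: w) / b (e :: w) - f w / b w) else 0) →
      ‖iterAvg (fun w => h w * g w) N []‖ ≤
        C * iterAvg (fun w => runMax a w * runMax γ w) N [] := by
  set D : ℝ := (Fintype.card E : ℝ) with hDdef
  have hD : 1 ≤ D := by rw [hDdef]; exact_mod_cast Fintype.card_pos
  set K := δ⁻¹ + δ⁻¹ ^ 2 + 2 * D * (δ⁻¹ ^ 2 + δ⁻¹ ^ 3) + 2 * δ⁻¹ + 2 * δ⁻¹ ^ 2 * B with hK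
  have hi : 0 < δ⁻¹ := by positivity
  have hK0 : 0 ≤ K := by positivity
  refine ⟨K * (2 * D + B ^ 2 + 3), by positivity, ?_⟩
  intro N f b g ε h a γ good _ hf hb hg ha hγ hfa hgγ hbB hbδ hgood hε h0 hh
  have ha0 : ∀ w, 0 ≤ a w := fun w => (norm_nonneg _).trans (hfa w)
  have hγ0 : ∀ w, 0 ≤ γ w := fun w => (norm_nonneg _).trans (hgγ w)
  set V := bilinearPotential f b g (runMax a) (runMax γ) good with hV
  have hdrift : ∀ w : List E, w.length < ([] : List E).length + N →
      ‖𝔼 e, h (e :: w) * g (e :: w) - h w * g w‖ ≤ 𝔼 e, K * V (e :: w) - K * V w := by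
    intro w hw
    have hw : w.length < N := by simpa using hw
    have hdr := drift_le_bilinearPotential (good := good) w (hf w hw) (hb w hw) (hg w hw)
      (ha w hw) (hγ w hw) hfa hgγ (fun e => hgood e w)
    have h1 : 𝔼 e, h (e :: w) * g (e :: w) - h w * g w =
        𝔼 e, (h (e :: w) - h w) * g (e :: w) := by
      simp only [sub_mul]
      rw [Finset.expect_sub_distrib, ← Finset.mul_expect, hg w hw]
    rw [h1, ← Finset.mul_expect, ← mul_sub]
    refine le_trans ?_ (mul_le_mul_of_nonneg_left hdr hK0)
    by_cases hgw : good w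
    · simp only [hgw, if_true]
      exact norm_expect_increment_mul_le (good := fun e => good (e :: w)) hδ hB hD
        (hf w hw) (hb w hw) ((hfa w).trans (le_runMax a w)) ((hgγ w).trans (le_runMax γ w))
        (fun e => (hfa _).trans (le_runMax a _)) (fun e => (hgγ _).trans (le_runMax γ _))
        (hbδ w hgw) (hbB w) (fun e => hbB _) (fun e he => hbδ _ he) (hε w)
        (fun e => runMax_le_cons a e w) (fun e => runMax_cons_le ha0 w (ha w hw) e)
        (fun e => runMax_cons_le hγ0 w (hγ w hw) e) (fun e => by rw [hh e w]; ring)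
    · have h2 : ∀ e, h (e :: w) - h w = 0 := fun e => by
        rw [hh e w, if_neg fun he => hgw (hgood e w he)]; ring
      simp only [h2, zero_mul, Finset.expect_const_zero, norm_zero]
      refine mul_nonneg hK0 (Finset.expect_nonneg fun e _ => ?_)
      have := runMax_nonneg ha0 w
      have := runMax_nonneg hγ0 w
      have : 0 ≤ (if good (e :: w) then 0 else
          if good w then runMax a (e :: w) * runMax γ (e :: w) else 0) := by simp [hgw]
      positivity
  have := norm_iterAvg_sub_le (X := fun w => h w * g w) (V := fun w => K * V w) N [] hdrift
  simp only [h0, zero_mul, sub_zero] at this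
  have hV0 : 0 ≤ V [] := bilinearPotential_nonneg (runMax_nonneg ha0 _) (runMax_nonneg hγ0 _)
  refine this.trans ((sub_le_self _ (mul_nonneg hK0 hV0)).trans ?_)
  rw [iterAvg_const_mul, mul_assoc, ← iterAvg_const_mul (2 * D + B ^ 2 + 3)]
  refine mul_le_mul_of_nonneg_left (iterAvg_mono _ _ fun w _ => ?_) hK0
  exact bilinearPotential_le ((hfa w).trans (le_runMax a w)) ((hgγ w).trans (le_runMax γ w)) (hbB w)

/-- The `L^p` bound for the twisted martingale transform on the tree, together with the maximal
inequality. The dual martingale is generated by `conj h * ‖h‖ ^ (p - 2)` in the last generation. -/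
lemma exists_transform_bound [Nonempty E] {p δ B : ℝ} (hp : 1 < p) (hδ : 0 < δ) (hB : 0 ≤ B) :
    ∃ C : ℝ, 0 ≤ C ∧ ∀ (N : ℕ) (f b ε h : List E → 𝕜) (a : List E → ℝ)
      (good : List E → Prop) [DecidablePred good],
      (∀ w, w.length < N → 𝔼 e, f (e :: w) = f w) →
      (∀ w, w.length < N → 𝔼 e, b (e :: w) = b w) →
      (∀ w, w.length < N → 𝔼 e, a (e :: w) = a w) →
      (∀ w, ‖f w‖ ≤ a w) → (∀ w, ‖b w‖ ≤ B) →
      (∀ w, good w → δ ≤ ‖b w‖) → (∀ e w, good (e :: w) → good w) → (∀ w, ‖ε w‖ ≤ 1) →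
      h [] = 0 →
      (∀ e w, h (e :: w) = h w +
        if good (e :: w) then ε w * (f (e :: w) / b (e :: w) - f w / b w) else 0) →
      iterAvg (fun w => ‖h w‖ ^ p) N [] + iterAvg (fun w => runMax a w ^ p) N [] ≤
        C * iterAvg (fun w => a w ^ p) N [] := by
  obtain ⟨q, hpq⟩ : ∃ q, p.HolderConjugate q := ⟨_, Real.HolderConjugate.conjExponent hp⟩
  obtain ⟨C₁, hC₁, H₁⟩ := exists_bilinear_bound (E := E) (𝕜 := 𝕜) hδ hB
  obtain ⟨C₂, hC₂, H₂⟩ := exists_doob (E := E) hp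
  obtain ⟨C₃, hC₃, H₃⟩ := exists_doob (E := E) hpq.symm.lt
  obtain ⟨C₄, hC₄, H₄⟩ := exists_young hpq.symm (η := 1 / (2 * (C₁ * C₃ + 1))) (by positivity)
  refine ⟨2 * (C₁ * C₄ * C₂) + C₂, by positivity, ?_⟩
  intro N f b ε h a good _ hf hb ha hfa hbB hbδ hgood hε h0 hh
  have ha0 : ∀ w, 0 ≤ a w := fun w => (norm_nonneg _).trans (hfa w)
  set u : List E → 𝕜 := fun w => (starRingEnd 𝕜) (h w) * ((‖h w‖ ^ (p - 2) : ℝ) : 𝕜) with hu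
  set g : List E → 𝕜 := fun w => iterAvg u (N - w.length) w with hg
  set γ : List E → ℝ := fun w => iterAvg (fun w => ‖u w‖) (N - w.length) w with hγ
  have hstep : ∀ w : List E, w.length < N →
      N - w.length = (N - (w.length + 1)) + 1 := fun w hw => by omega
  have hgm : ∀ w : List E, w.length < N → 𝔼 e, g (e :: w) = g w := by
    intro w hw
    simp only [hg, List.length_cons]
    rw [hstep w hw]
    rfl
  have hγm : ∀ w : List E, w.length < N → 𝔼 e, γ (e :: w) = γ w := by
    intro w hw
    simp only [hγ, List.length_cons]
    rw [hstep w hw]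
    rfl
  have hγ0 : ∀ w, 0 ≤ γ w := fun w => iterAvg_nonneg (fun _ => norm_nonneg _) _ _
  have hbil := H₁ N f b g ε h a γ good hf hb hgm ha hγm hfa (fun w => norm_iterAvg_le _ _ _)
    hbB hbδ hgood hε h0 hh
  have hun : ∀ w, ‖u w‖ = ‖h w‖ ^ (p - 1) := by
    intro w
    rw [hu]
    simp only [norm_mul, RCLike.norm_conj, RCLike.norm_ofReal]
    rw [abs_of_nonneg (by positivity), mul_comm, ← Real.rpow_add_one' (norm_nonneg _)]
    · ring_nf
    · intro hc; linarith
  have hhu : ∀ w, h w * u w = ((‖h w‖ ^ p : ℝ) : 𝕜) := by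
    intro w
    simp only [hu]
    rw [← mul_assoc, RCLike.mul_conj, ← RCLike.ofReal_pow, ← RCLike.ofReal_mul, ← Real.rpow_natCast,
      ← Real.rpow_add' (norm_nonneg _)]
    · congr 2; push_cast; ring
    · push_cast; intro hc; linarith
  have hleaf : ∀ w : List E, w.length = ([] : List E).length + N → N - w.length = 0 := by
    intro w hw
    simp only [List.length_nil] at hw
    omega
  have hpair : iterAvg (fun w => h w * g w) N [] =
      ((iterAvg (fun w => ‖h w‖ ^ p) N [] : ℝ) : 𝕜) := by
    rw [← ofReal_iterAvg]
    refine iterAvg_congr N [] fun w hw => ?_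
    simp only [hg, hleaf w hw]
    exact hhu w
  have hX0 : 0 ≤ iterAvg (fun w => ‖h w‖ ^ p) N [] := iterAvg_nonneg (fun w => by positivity) _ _
  rw [hpair, RCLike.norm_ofReal, abs_of_nonneg hX0] at hbil
  have hd1 := H₂ N a ha0 ha
  have hd2 := H₃ N γ hγ0 hγm
  have hγq : iterAvg (fun w => γ w ^ q) N [] = iterAvg (fun w => ‖h w‖ ^ p) N [] := by
    refine iterAvg_congr N [] fun w hw => ?_
    simp only [hγ, hleaf w hw]
    change ‖u w‖ ^ q = _
    rw [hun, ← Real.rpow_mul (norm_nonneg _), hpq.sub_one_mul_conj]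
  rw [hγq] at hd2
  have hy : iterAvg (fun w => runMax a w * runMax γ w) N [] ≤
      1 / (2 * (C₁ * C₃ + 1)) * iterAvg (fun w => runMax γ w ^ q) N [] +
        C₄ * iterAvg (fun w => runMax a w ^ p) N [] := by
    rw [← iterAvg_const_mul, ← iterAvg_const_mul, ← iterAvg_add]
    refine iterAvg_mono N [] fun w _ => ?_
    rw [mul_comm]
    exact H₄ _ _ (runMax_nonneg hγ0 w) (runMax_nonneg ha0 w)
  set X := iterAvg (fun w => ‖h w‖ ^ p) N []
  set Y := iterAvg (fun w => runMax a w * runMax γ w) N []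
  set Z := iterAvg (fun w => runMax γ w ^ q) N []
  set W := iterAvg (fun w => runMax a w ^ p) N []
  set R := iterAvg (fun w => a w ^ p) N []
  have hX : X ≤ 1 / 2 * X + C₁ * C₄ * C₂ * R := by
    calc X ≤ C₁ * Y := hbil
      _ ≤ C₁ * (1 / (2 * (C₁ * C₃ + 1)) * (C₃ * X) + C₄ * (C₂ * R)) := by
        refine mul_le_mul_of_nonneg_left (hy.trans ?_) hC₁
        gcongr
      _ = 1 / 2 * ((C₁ * C₃) / (C₁ * C₃ + 1) * X) + C₁ * C₄ * C₂ * R := by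
        have : C₁ * C₃ + 1 ≠ 0 := by positivity
        field_simp
      _ ≤ _ := by
        have h1 : (C₁ * C₃) / (C₁ * C₃ + 1) ≤ 1 := by
          rw [div_le_one (by positivity)]; linarith
        have := mul_le_mul_of_nonneg_right h1 hX0
        linarith
  linarith

end TransformBound

/-! ### Unconditional convergence from uniform convexity -/

section UniformConvexity

variable {𝕜 : Type*} [RCLike 𝕜]

lemma rpow_norm_lt_average {p : ℝ} (hp : 1 < p) (x : 𝕜) {y : 𝕜} (hy : y ≠ 0) :
    ‖x‖ ^ p < (‖x + y‖ ^ p + ‖x - y‖ ^ p) / 2 := by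
  have hy' : 0 < ‖y‖ := norm_pos_iff.2 hy
  have hpar := parallelogram_law_with_norm 𝕜 x y
  rcases eq_or_ne ‖x + y‖ ‖x - y‖ with h | h
  · rw [h] at hpar ⊢
    have h1 : ‖x‖ < ‖x - y‖ := by
      refine lt_of_pow_lt_pow_left₀ 2 (norm_nonneg _) ?_
      nlinarith
    have := Real.rpow_lt_rpow (norm_nonneg _) h1 (by linarith : 0 < p)
    linarith
  · have h1 := (strictConvexOn_rpow hp).2 (Set.mem_Ici.2 (norm_nonneg (x + y)))
      (Set.mem_Ici.2 (norm_nonneg (x - y))) h (by norm_num : (0 : ℝ) < 1 / 2)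
      (by norm_num : (0 : ℝ) < 1 / 2) (by norm_num)
    simp only [smul_eq_mul] at h1
    have h2 : ‖x‖ ≤ 1 / 2 * ‖x + y‖ + 1 / 2 * ‖x - y‖ := by
      have h3 : (2 : 𝕜) * x = (x + y) + (x - y) := by ring
      have h4 := norm_add_le (x + y) (x - y)
      rw [← h3, norm_mul, RCLike.norm_ofNat] at h4
      linarith
    have h3 := Real.rpow_le_rpow (norm_nonneg _) h2 (by linarith : 0 ≤ p)
    linarith

/-- A quantitative form of the uniform convexity of `‖·‖ ^ p`. By homogeneity the constant comes
from the minimum of a positive continuous function on a compact set. -/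
lemma exists_rpow_norm_le {p θ : ℝ} (hp : 1 < p) (hθ : 0 < θ) :
    ∃ K : ℝ, 0 ≤ K ∧ ∀ x y : 𝕜,
      ‖y‖ ^ p ≤ θ * ‖x‖ ^ p + K * ((‖x + y‖ ^ p + ‖x - y‖ ^ p) / 2 - ‖x‖ ^ p) := by
  have hp0 : 0 < p := by linarith
  set R : ℝ := (1 / θ) ^ (1 / p) with hR
  have hR0 : 0 < R := by positivity
  have hcont : Continuous fun z : 𝕜 × 𝕜 =>
      (‖z.1 + z.2‖ ^ p + ‖z.1 - z.2‖ ^ p) / 2 - ‖z.1‖ ^ p := by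
    have : ∀ g : 𝕜 × 𝕜 → 𝕜, Continuous g → Continuous fun z => ‖g z‖ ^ p :=
      fun g hg => hg.norm.rpow_const fun _ => Or.inr hp0.le
    exact (((this _ (continuous_fst.add continuous_snd)).add
      (this _ (continuous_fst.sub continuous_snd))).div_const _).sub (this _ continuous_fst)
  have hcpt : IsCompact (Metric.closedBall (0 : 𝕜) R ×ˢ Metric.sphere (0 : 𝕜) 1) :=
    (isCompact_closedBall _ _).prod (isCompact_sphere _ _)
  have hne : (Metric.closedBall (0 : 𝕜) R ×ˢ Metric.sphere (0 : 𝕜) 1).Nonempty :=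
    ⟨(0, 1), by simp [hR0.le]⟩
  obtain ⟨z, hz, hmin⟩ := hcpt.exists_isMinOn hne hcont.continuousOn
  set c := (‖z.1 + z.2‖ ^ p + ‖z.1 - z.2‖ ^ p) / 2 - ‖z.1‖ ^ p with hc
  have hc0 : 0 < c := by
    have hz2 : z.2 ≠ 0 := by
      have : ‖z.2‖ = 1 := by simpa using hz.2
      exact norm_pos_iff.1 (by rw [this]; exact one_pos)
    have := rpow_norm_lt_average hp z.1 hz2
    rw [hc]; linarith
  refine ⟨c⁻¹, by positivity, fun x y => ?_⟩
  rcases eq_or_ne y 0 with rfl | hy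
  · simp only [norm_zero, add_zero, sub_zero, Real.zero_rpow hp0.ne']
    have : (0 : ℝ) ≤ ‖x‖ ^ p := by positivity
    ring_nf
    positivity
  have hpos := rpow_norm_lt_average hp x hy
  have hy0 : 0 < ‖y‖ := norm_pos_iff.2 hy
  by_cases hxy : ‖x‖ ≤ R * ‖y‖
  · have hscale : ∀ v : 𝕜, ‖((‖y‖⁻¹ : ℝ) : 𝕜) * v‖ ^ p = (‖y‖ ^ p)⁻¹ * ‖v‖ ^ p := by
      intro v
      rw [norm_mul, RCLike.norm_ofReal, abs_of_nonneg (by positivity),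
        Real.mul_rpow (by positivity) (norm_nonneg _), Real.inv_rpow hy0.le]
    have hmem : (((‖y‖⁻¹ : ℝ) : 𝕜) * x, ((‖y‖⁻¹ : ℝ) : 𝕜) * y) ∈
        Metric.closedBall (0 : 𝕜) R ×ˢ Metric.sphere (0 : 𝕜) 1 := by
      constructor
      · simp only [mem_closedBall_zero_iff, norm_mul, RCLike.norm_ofReal, abs_inv, abs_norm]
        rw [inv_mul_le_iff₀ hy0]; linarith
      · simp only [mem_sphere_zero_iff_norm, norm_mul, RCLike.norm_ofReal, abs_inv, abs_norm]
        exact inv_mul_cancel₀ hy0.ne'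
    have h1 := hmin hmem
    simp only [Set.mem_ofPred_eq, ← mul_add, ← mul_sub, hscale] at h1
    have hyp : 0 < ‖y‖ ^ p := by positivity
    have h2 : c * ‖y‖ ^ p ≤ (‖x + y‖ ^ p + ‖x - y‖ ^ p) / 2 - ‖x‖ ^ p := by
      have h3 := mul_le_mul_of_nonneg_right h1 hyp.le
      refine h3.trans (le_of_eq ?_)
      field_simp
    have h4 : ‖y‖ ^ p ≤ c⁻¹ * ((‖x + y‖ ^ p + ‖x - y‖ ^ p) / 2 - ‖x‖ ^ p) := by
      rw [← div_eq_inv_mul, le_div_iff₀ hc0]; linarith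
    have : (0 : ℝ) ≤ θ * ‖x‖ ^ p := by positivity
    linarith
  · have h1 : (R * ‖y‖) ^ p ≤ ‖x‖ ^ p := Real.rpow_le_rpow (by positivity) (not_le.1 hxy).le hp0.le
    rw [Real.mul_rpow hR0.le hy0.le, hR, ← Real.rpow_mul (by positivity),
      one_div_mul_cancel hp0.ne', Real.rpow_one, one_div, inv_mul_le_iff₀ hθ] at h1
    have : 0 ≤ c⁻¹ * ((‖x + y‖ ^ p + ‖x - y‖ ^ p) / 2 - ‖x‖ ^ p) :=
      mul_nonneg (by positivity) (by linarith)
    linarith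

/-- In a uniformly convex Banach space a series with bounded sign-weighted partial sums is
unconditionally summable. Otherwise there would be disjoint blocks `x`, `y`, almost as large as
possible, and the norms of `x + y` and `x - y` could not exceed that of `x`. -/
lemma summable_of_bounded_of_uniformConvex {V ι : Type*} [NormedAddCommGroup V] [NormedSpace ℝ V]
    [CompleteSpace V] {p : ℝ} (hp : 0 < p)
    (hV : ∀ θ : ℝ, 0 < θ → ∃ K : ℝ, 0 ≤ K ∧ ∀ x y : V,
      ‖y‖ ^ p ≤ θ * ‖x‖ ^ p + K * ((‖x + y‖ ^ p + ‖x - y‖ ^ p) / 2 - ‖x‖ ^ p))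
    (X : ι → V) (M : ℝ)
    (hM : ∀ σ : ι →₀ ℝ, (∀ i, |σ i| ≤ 1) → ‖Finsupp.linearCombination ℝ X σ‖ ≤ M) :
    Summable X := by
  classical
  set L := Finsupp.linearCombination ℝ X with hL
  set P : Finset ι → Set ℝ := fun F =>
    {r | ∃ σ : ι →₀ ℝ, (∀ i, |σ i| ≤ 1) ∧ (∀ i ∈ F, σ i = 0) ∧ ‖L σ‖ = r} with hP
  have hbdd : ∀ F, BddAbove (P F) := by
    rintro F
    refine ⟨M, ?_⟩
    rintro _ ⟨σ, h1, _, rfl⟩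
    exact hM σ h1
  have hzero : ∀ F, (0 : ℝ) ∈ P F := fun F => ⟨0, by simp, by simp, by simp⟩
  have hS0 : ∀ F, 0 ≤ sSup (P F) := fun F => le_csSup (hbdd F) (hzero F)
  have hle : ∀ F σ, (∀ i, |σ i| ≤ 1) → (∀ i ∈ F, σ i = 0) → ‖L σ‖ ≤ sSup (P F) :=
    fun F σ h1 h2 => le_csSup (hbdd F) ⟨σ, h1, h2, rfl⟩
  have hbelow : BddBelow (Set.range fun F => sSup (P F)) := ⟨0, by rintro _ ⟨F, rfl⟩; exact hS0 F⟩
  set m := ⨅ F, sSup (P F) with hm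
  have hm0 : 0 ≤ m := le_ciInf hS0
  have hmz : m = 0 := by
    by_contra hne
    have hmpos : 0 < m := lt_of_le_of_ne hm0 (Ne.symm hne)
    obtain ⟨K, hK, hUC⟩ := hV (1 / 2) (by norm_num)
    have hcont : ContinuousAt (fun η : ℝ => 1 / 2 * (m + η) ^ p +
        K * ((m + η) ^ p - (m - η) ^ p) - (m - η) ^ p) 0 := by
      have h1 : ContinuousAt (fun η : ℝ => (m + η) ^ p) 0 :=
        (continuousAt_const.add continuousAt_id).rpow_const (Or.inr hp.le)
      have h2 : ContinuousAt (fun η : ℝ => (m - η) ^ p) 0 :=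
        (continuousAt_const.sub continuousAt_id).rpow_const (Or.inr hp.le)
      exact ((continuousAt_const.mul h1).add (continuousAt_const.mul (h1.sub h2))).sub h2
    have hneg : ∀ᶠ η in 𝓝[>] (0 : ℝ), 1 / 2 * (m + η) ^ p +
        K * ((m + η) ^ p - (m - η) ^ p) - (m - η) ^ p < 0 := by
      refine (hcont.eventually_lt continuousAt_const ?_).filter_mono nhdsWithin_le_nhds
      have : 0 < m ^ p := by positivity
      simp only [add_zero, sub_zero, sub_self, mul_zero]
      linarith
    obtain ⟨η, hη, hη0, hηm⟩ := (hneg.and (Ioo_mem_nhdsGT hmpos)).exists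
    obtain ⟨F, hF⟩ := exists_lt_of_ciInf_lt (show ⨅ F, sSup (P F) < m + η by linarith)
    have hlarge : ∀ F' : Finset ι, ∃ σ : ι →₀ ℝ,
        (∀ i, |σ i| ≤ 1) ∧ (∀ i ∈ F', σ i = 0) ∧ m - η < ‖L σ‖ := by
      intro F'
      have h1 : m - η < sSup (P F') := by
        have := ciInf_le hbelow F'
        linarith
      obtain ⟨_, ⟨σ, h2, h3, rfl⟩, h4⟩ := exists_lt_of_lt_csSup ⟨0, hzero F'⟩ h1
      exact ⟨σ, h2, h3, h4⟩
    obtain ⟨σ, hσ1, hσF, hσ⟩ := hlarge F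
    obtain ⟨τ, hτ1, hτF, hτ⟩ := hlarge (F ∪ σ.support)
    have hdisj : ∀ i, σ i = 0 ∨ τ i = 0 := by
      intro i
      by_cases hi : σ i = 0
      · exact Or.inl hi
      · exact Or.inr (hτF i (Finset.mem_union_right _ (Finsupp.mem_support_iff.2 hi)))
    have hτF' : ∀ i ∈ F, τ i = 0 := fun i hi => hτF i (Finset.mem_union_left _ hi)
    have hadd : ‖L σ + L τ‖ ≤ m + η := by
      rw [← map_add]
      refine (hle F (σ + τ) (fun i => ?_) fun i hi => ?_).trans hF.le
      · rcases hdisj i with h | h <;> simp [h, hσ1, hτ1]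
      · simp [hσF i hi, hτF' i hi]
    have hsub : ‖L σ - L τ‖ ≤ m + η := by
      rw [← map_sub]
      refine (hle F (σ - τ) (fun i => ?_) fun i hi => ?_).trans hF.le
      · rcases hdisj i with h | h <;> simp [h, hσ1, hτ1]
      · simp [hσF i hi, hτF' i hi]
    have hσm : ‖L σ‖ ≤ m + η := (hle F σ hσ1 hσF).trans hF.le
    have hge : 0 ≤ m - η := by linarith
    have key := hUC (L σ) (L τ)
    have k1 : (m - η) ^ p ≤ ‖L σ‖ ^ p := Real.rpow_le_rpow hge hσ.le hp.le
    have k2 : (m - η) ^ p ≤ ‖L τ‖ ^ p := Real.rpow_le_rpow hge hτ.le hp.le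
    have k3 : ‖L σ‖ ^ p ≤ (m + η) ^ p := Real.rpow_le_rpow (norm_nonneg _) hσm hp.le
    have k4 : ‖L σ + L τ‖ ^ p ≤ (m + η) ^ p := Real.rpow_le_rpow (norm_nonneg _) hadd hp.le
    have k5 : ‖L σ - L τ‖ ^ p ≤ (m + η) ^ p := Real.rpow_le_rpow (norm_nonneg _) hsub hp.le
    have k6 : K * ((‖L σ + L τ‖ ^ p + ‖L σ - L τ‖ ^ p) / 2 - ‖L σ‖ ^ p) ≤
        K * ((m + η) ^ p - (m - η) ^ p) := by
      refine mul_le_mul_of_nonneg_left ?_ hK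
      linarith
    linarith
  rw [summable_iff_vanishing_norm]
  intro ε hε
  obtain ⟨F, hF⟩ := exists_lt_of_ciInf_lt (show ⨅ F, sSup (P F) < ε by rw [← hm, hmz]; exact hε)
  refine ⟨F, fun t ht => ?_⟩
  refine lt_of_le_of_lt ?_ hF
  have h1 : ∑ i ∈ t, X i = L (∑ i ∈ t, Finsupp.single i 1) := by
    rw [map_sum]
    simp [hL, Finsupp.linearCombination_single]
  have h2 : ∀ j, (∑ i ∈ t, Finsupp.single i (1 : ℝ)) j = if j ∈ t then 1 else 0 := by
    intro j
    simp [Finsupp.finsetSum_apply, Finsupp.single_apply]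
  rw [h1]
  refine hle F _ (fun i => ?_) fun i hi => ?_
  · rw [h2]; split_ifs <;> simp
  · rw [h2, if_neg fun hit => Finset.disjoint_left.1 ht hit hi]

lemma Lp_norm_rpow_eq {α : Type*} [MeasurableSpace α] {μ : Measure α} {p : ℝ} (hp : 0 < p)
    (u : Lp 𝕜 (ENNReal.ofReal p) μ) : ‖u‖ ^ p = ∫ x, ‖u x‖ ^ p ∂μ := by
  have h0 : ENNReal.ofReal p ≠ 0 := by simpa using hp
  rw [Lp.norm_def, (Lp.memLp u).eLpNorm_eq_integral_rpow_norm h0 ENNReal.ofReal_ne_top,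
    ENNReal.toReal_ofReal hp.le, ENNReal.toReal_ofReal (by positivity),
    ← Real.rpow_mul (by positivity), inv_mul_cancel₀ hp.ne', Real.rpow_one]

lemma exists_Lp_norm_rpow_le {α : Type*} [MeasurableSpace α] {μ : Measure α} {p θ : ℝ}
    (hp : 1 < p) (hθ : 0 < θ) :
    ∃ K : ℝ, 0 ≤ K ∧ ∀ x y : Lp 𝕜 (ENNReal.ofReal p) μ,
      ‖y‖ ^ p ≤ θ * ‖x‖ ^ p + K * ((‖x + y‖ ^ p + ‖x - y‖ ^ p) / 2 - ‖x‖ ^ p) := by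
  obtain ⟨K, hK, H⟩ := exists_rpow_norm_le (𝕜 := 𝕜) hp hθ
  have hp0 : 0 < p := by linarith
  refine ⟨K, hK, fun x y => ?_⟩
  have hint : ∀ u : Lp 𝕜 (ENNReal.ofReal p) μ, Integrable (fun t => ‖u t‖ ^ p) μ := by
    intro u
    have := (Lp.memLp u).integrable_norm_rpow (by simpa using hp0) ENNReal.ofReal_ne_top
    rwa [ENNReal.toReal_ofReal hp0.le] at this
  simp only [Lp_norm_rpow_eq hp0]
  have h1 : (∫ t, ‖(x + y) t‖ ^ p ∂μ) = ∫ t, ‖x t + y t‖ ^ p ∂μ :=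
    integral_congr_ae ((Lp.coeFn_add x y).mono fun t ht => by simp only [ht, Pi.add_apply])
  have h2 : (∫ t, ‖(x - y) t‖ ^ p ∂μ) = ∫ t, ‖x t - y t‖ ^ p ∂μ :=
    integral_congr_ae ((Lp.coeFn_sub x y).mono fun t ht => by simp only [ht, Pi.sub_apply])
  have i1 : Integrable (fun t => ‖x t + y t‖ ^ p) μ :=
    (hint (x + y)).congr ((Lp.coeFn_add x y).mono fun t ht => by simp only [ht, Pi.add_apply])
  have i2 : Integrable (fun t => ‖x t - y t‖ ^ p) μ :=
    (hint (x - y)).congr ((Lp.coeFn_sub x y).mono fun t ht => by simp only [ht, Pi.sub_apply])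
  have i3 : Integrable (fun t => (‖x t + y t‖ ^ p + ‖x t - y t‖ ^ p) / 2) μ :=
    (i1.add i2).div_const 2
  have i4 : Integrable (fun t => K * ((‖x t + y t‖ ^ p + ‖x t - y t‖ ^ p) / 2 - ‖x t‖ ^ p)) μ :=
    (i3.sub (hint x)).const_mul K
  rw [h1, h2, ← integral_add i1 i2, ← integral_div, ← integral_sub i3 (hint x),
    ← integral_const_mul, ← integral_const_mul, ← integral_add ((hint x).const_mul θ) i4]
  exact integral_mono (hint y) (((hint x).const_mul θ).add i4) fun t => H (x t) (y t)

end UniformConvexity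

/-! ### Geometry of dyadic cubes -/

namespace DyadicCube

variable {n : ℕ}

lemma le_iff {Q R : DyadicCube n} : Q ≤ R ↔ Q.toSet ⊆ R.toSet := Iff.rfl

lemma mem_toSet_iff {Q : DyadicCube n} {x : Fin n → ℝ} :
    x ∈ Q.toSet ↔ ∀ i, ⌊(2 : ℝ) ^ Q.scale * x i⌋ = Q.pos i := by
  have h : (0 : ℝ) < 2 ^ Q.scale := by positivity
  simp only [toSet, Set.mem_univ_pi, Set.mem_Ico, Int.floor_eq_iff, zpow_neg]
  refine forall_congr' fun i => ?_
  rw [inv_mul_le_iff₀ h, lt_inv_mul_iff₀ h]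

lemma measurableSet_toSet (Q : DyadicCube n) : MeasurableSet Q.toSet :=
  MeasurableSet.univ_pi fun _ => measurableSet_Ico

lemma volume_toSet (Q : DyadicCube n) :
    volume Q.toSet = ENNReal.ofReal (((2 : ℝ) ^ (-Q.scale)) ^ n) := by
  rw [toSet, Real.volume_pi_Ico, ENNReal.ofReal_pow (by positivity)]
  have : ∀ i, (2 : ℝ) ^ (-Q.scale) * (Q.pos i + 1) - 2 ^ (-Q.scale) * Q.pos i =
      2 ^ (-Q.scale) := fun i => by ring
  simp only [this, Finset.prod_const, Finset.card_univ, Fintype.card_fin]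

lemma volumeReal_toSet (Q : DyadicCube n) :
    volume.real Q.toSet = ((2 : ℝ) ^ (-Q.scale)) ^ n := by
  rw [Measure.real, volume_toSet, ENNReal.toReal_ofReal (by positivity)]

lemma volumeReal_pos (Q : DyadicCube n) : 0 < volume.real Q.toSet := by
  rw [volumeReal_toSet]; positivity

lemma volume_ne_top (Q : DyadicCube n) : volume Q.toSet ≠ ∞ := by
  rw [volume_toSet]; exact ENNReal.ofReal_ne_top

lemma volume_ne_zero (Q : DyadicCube n) : volume Q.toSet ≠ 0 := by
  rw [volume_toSet]; simpa using by positivity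

lemma nonempty (Q : DyadicCube n) : Q.toSet.Nonempty :=
  nonempty_of_measure_ne_zero Q.volume_ne_zero

lemma eq_of_mem {Q R : DyadicCube n} (h : Q.scale = R.scale) {x : Fin n → ℝ} (hQ : x ∈ Q.toSet)
    (hR : x ∈ R.toSet) : Q = R := by
  have h1 := mem_toSet_iff.1 hQ
  have h2 := mem_toSet_iff.1 hR
  cases Q; cases R
  simp only at h h1 h2
  subst h
  congr
  funext i
  rw [← h1 i, ← h2 i]

lemma le_of_mem {Q R : DyadicCube n} (h : R.scale ≤ Q.scale) {x : Fin n → ℝ} (hQ : x ∈ Q.toSet)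
    (hR : x ∈ R.toSet) : Q ≤ R := by
  obtain ⟨k, hk⟩ := Int.le.dest h
  have hfl : ∀ t : ℝ, ⌊(2 : ℝ) ^ R.scale * t⌋ = ⌊(2 : ℝ) ^ Q.scale * t⌋ / ((2 ^ k : ℕ) : ℤ) := by
    intro t
    rw [← Int.floor_div_natCast, ← hk, zpow_add₀ two_ne_zero]
    congr 1
    push_cast
    rw [zpow_natCast]
    field_simp
  intro y hy
  rw [mem_toSet_iff] at *
  intro i
  rw [hfl, hy i, ← hQ i, ← hfl, hR i]

lemma scale_le_of_le (hn : 1 ≤ n) {Q R : DyadicCube n} (h : Q ≤ R) : R.scale ≤ Q.scale := by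
  have h1 := measureReal_mono (μ := volume) (le_iff.1 h) R.volume_ne_top
  rw [volumeReal_toSet, volumeReal_toSet] at h1
  have h2 := le_of_pow_le_pow_left₀ (by omega) (by positivity) h1
  have := (zpow_le_zpow_iff_right₀ (by norm_num : (1 : ℝ) < 2)).1 h2
  omega

lemma mem_child_iff {Q : DyadicCube n} {e : Fin n → Fin 2} {x : Fin n → ℝ} :
    x ∈ (Q.child e).toSet ↔
      ∀ i, ⌊(2 : ℝ) ^ (Q.scale + 1) * x i⌋ = 2 * Q.pos i + (e i : ℕ) := mem_toSet_iff

lemma floor_eq_half_floor (k : ℤ) (t : ℝ) : ⌊(2 : ℝ) ^ k * t⌋ = ⌊(2 : ℝ) ^ (k + 1) * t⌋ / 2 := by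
  have := Int.floor_div_natCast ((2 : ℝ) ^ (k + 1) * t) 2
  push_cast at this
  rw [← this, zpow_add₀ two_ne_zero, zpow_one]
  congr 1
  ring

lemma child_le (Q : DyadicCube n) (e : Fin n → Fin 2) : Q.child e ≤ Q := by
  intro x hx
  rw [mem_child_iff] at hx
  rw [mem_toSet_iff]
  intro i
  have := (e i).isLt
  rw [floor_eq_half_floor, hx i]
  omega

lemma exists_mem_child {Q : DyadicCube n} {x : Fin n → ℝ} (hx : x ∈ Q.toSet) :
    ∃ e, x ∈ (Q.child e).toSet := by
  rw [mem_toSet_iff] at hx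
  refine ⟨fun i => ⟨(⌊(2 : ℝ) ^ (Q.scale + 1) * x i⌋ - 2 * Q.pos i).toNat, ?_⟩, ?_⟩
  · have := hx i
    rw [floor_eq_half_floor] at this
    omega
  · rw [mem_child_iff]
    intro i
    have := hx i
    rw [floor_eq_half_floor] at this
    simp only
    omega

lemma child_injective (Q : DyadicCube n) : Function.Injective Q.child := by
  intro e e' h
  funext i
  have h1 := congrFun (congrArg DyadicCube.pos h) i
  simp only [child] at h1
  exact Fin.ext (by omega)

lemma pairwise_disjoint_child (Q : DyadicCube n) :
    Pairwise (Function.onFun Disjoint fun e => (Q.child e).toSet) := by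
  intro e e' hne
  refine Set.disjoint_left.2 fun x hx hx' => hne (Q.child_injective ?_)
  exact eq_of_mem rfl hx hx'

lemma iUnion_child (Q : DyadicCube n) : ⋃ e, (Q.child e).toSet = Q.toSet := by
  ext x
  simp only [Set.mem_iUnion]
  exact ⟨fun ⟨e, he⟩ => Q.child_le e he, exists_mem_child⟩

lemma volumeReal_eq_two_pow_mul_child (Q : DyadicCube n) (e : Fin n → Fin 2) :
    volume.real Q.toSet = 2 ^ n * volume.real (Q.child e).toSet := by
  rw [volumeReal_toSet, volumeReal_toSet, ← mul_pow]
  congr 1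
  change _ = 2 * (2 : ℝ) ^ (-(Q.scale + 1))
  rw [neg_add, zpow_add₀ two_ne_zero]
  norm_num
  ring

open scoped BigOperators in
lemma expect_average_child {𝕜 : Type*} [RCLike 𝕜] (Q : DyadicCube n) {ψ : (Fin n → ℝ) → 𝕜}
    (hψ : IntegrableOn ψ Q.toSet) :
    𝔼 e, ⨍ x in (Q.child e).toSet, ψ x = ⨍ x in Q.toSet, ψ x := by
  have h1 : ∫ x in Q.toSet, ψ x = ∑ e, ∫ x in (Q.child e).toSet, ψ x := by
    conv_lhs => rw [← Q.iUnion_child]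
    exact integral_iUnion_fintype (fun e => measurableSet_toSet _) Q.pairwise_disjoint_child
      fun e => hψ.mono_set (Q.child_le e)
  rw [setAverage_eq, h1, Fintype.expect_eq_sum_div_card, Finset.smul_sum, Finset.sum_div]
  refine Finset.sum_congr rfl fun e _ => ?_
  rw [setAverage_eq, Q.volumeReal_eq_two_pow_mul_child e, RCLike.real_smul_eq_coe_mul,
    RCLike.real_smul_eq_coe_mul]
  simp only [Fintype.card_fun, Fintype.card_fin]
  push_cast
  field_simp

lemma norm_average_le {𝕜 : Type*} [RCLike 𝕜] (Q : DyadicCube n) (ψ : (Fin n → ℝ) → 𝕜) :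
    ‖⨍ x in Q.toSet, ψ x‖ ≤ ⨍ x in Q.toSet, ‖ψ x‖ := by
  rw [setAverage_eq, setAverage_eq, norm_smul, Real.norm_of_nonneg (by positivity), smul_eq_mul]
  gcongr
  exact norm_integral_le_integral_norm _

lemma average_norm_rpow_le {𝕜 : Type*} [RCLike 𝕜] (Q : DyadicCube n) {ψ : (Fin n → ℝ) → 𝕜}
    {p : ℝ} (hp : 1 ≤ p) (hψ : IntegrableOn ψ Q.toSet)
    (hψp : IntegrableOn (fun x => ‖ψ x‖ ^ p) Q.toSet) :
    (⨍ x in Q.toSet, ‖ψ x‖) ^ p ≤ ⨍ x in Q.toSet, ‖ψ x‖ ^ p :=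
  (convexOn_rpow hp).map_set_average_le (f := fun x => ‖ψ x‖)
    (Real.continuous_rpow_const (by linarith)).continuousOn
    isClosed_Ici Q.volume_ne_zero Q.volume_ne_top (Eventually.of_forall fun x => norm_nonneg _)
    hψ.norm hψp

end DyadicCube

/-! ### Nonterminal cubes and the tree of cubes below `S₀` -/

section Nodes

open DyadicCube

variable {n : ℕ}

lemma mem_nonterminalCubes_of_le {S₀ Q R : DyadicCube n} {𝒯 : Set (DyadicCube n)}
    (hQ : Q ∈ nonterminalCubes S₀ 𝒯) (hQR : Q ≤ R) (hR : R ≤ S₀) : R ∈ nonterminalCubes S₀ 𝒯 :=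
  ⟨hR, fun T hT hRT => hQ.2 T hT (hQR.trans hRT)⟩

lemma child_mem_or (hn : 1 ≤ n) {S₀ Q : DyadicCube n} {𝒯 : Set (DyadicCube n)}
    (hQ : Q ∈ nonterminalCubes S₀ 𝒯) (e : Fin n → Fin 2) :
    Q.child e ∈ 𝒯 ∨ Q.child e ∈ nonterminalCubes S₀ 𝒯 := by
  by_contra! h
  have h2 : ∃ T ∈ 𝒯, Q.child e ≤ T := by
    by_contra! h'
    exact h.2 ⟨(Q.child_le e).trans hQ.1, h'⟩
  obtain ⟨T, hT, hle⟩ := h2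
  obtain ⟨x, hx⟩ := (Q.child e).nonempty
  have hs := scale_le_of_le hn hle
  rcases hs.eq_or_lt with heq | hlt
  · exact h.1 (eq_of_mem heq.symm hx (hle hx) ▸ hT)
  · exact hQ.2 T hT (le_of_mem (Int.lt_add_one_iff.1 hlt) (Q.child_le e hx) (hle hx))

/-- A nonterminal cube does not satisfy the stopping condition: otherwise it would lie in a maximal
stopping cube, hence in a terminal cube. -/
lemma not_stoppingCondition (hn : 1 ≤ n) {𝕜 : Type*} [RCLike 𝕜] {p : ℝ} {A : ℝ≥0} {δ : ℝ}
    {b : (Fin n → ℝ) → 𝕜} {S₀ Q : DyadicCube n} {𝒯 : Set (DyadicCube n)}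
    (h𝒯 : IsTerminalFamily p A δ b S₀ 𝒯) (hQ : Q ∈ nonterminalCubes S₀ 𝒯) :
    ¬ StoppingCondition p A δ b Q := by
  classical
  intro hSt
  have hex : ∃ k : ℕ, ∃ R : DyadicCube n, Q ≤ R ∧ R ≤ S₀ ∧ StoppingCondition p A δ b R ∧
      R.scale = S₀.scale + k := by
    obtain ⟨k, hk⟩ := Int.le.dest (scale_le_of_le hn hQ.1)
    exact ⟨k, Q, le_rfl, hQ.1, hSt, hk.symm⟩
  obtain ⟨R, hQR, hR, hRs, hRk⟩ := Nat.find_spec hex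
  have hmax : R ∈ stoppingCubes p A δ b S₀ := by
    refine ⟨⟨hR, hRs⟩, fun R' hR' hle => ?_⟩
    obtain ⟨k, hk⟩ := Int.le.dest (scale_le_of_le hn hR'.1)
    have h1 := Nat.find_min' hex ⟨R', hQR.trans hle, hR'.1, hR'.2, hk.symm⟩
    have h2 := scale_le_of_le hn hle
    obtain ⟨x, hx⟩ := R.nonempty
    have : R = R' := eq_of_mem (by omega) hx (hle hx)
    exact this ▸ le_rfl
  obtain ⟨T, hT, hle⟩ := h𝒯.covers R hmax
  exact hQ.2 T hT (hQR.trans hle)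

open Classical in
/-- The cube reached from `S₀` by the path `w` of children (the last letter of the path being the
head of `w`). A path stays put once it has reached a terminal cube, so that averages over the
nodes form martingales on the full tree. -/
noncomputable def node (S₀ : DyadicCube n) (𝒯 : Set (DyadicCube n)) :
    List (Fin n → Fin 2) → DyadicCube n
  | [] => S₀
  | e :: w => if node S₀ 𝒯 w ∈ 𝒯 then node S₀ 𝒯 w else (node S₀ 𝒯 w).child e

variable {S₀ : DyadicCube n} {𝒯 : Set (DyadicCube n)}

lemma node_cons_of_mem {w : List (Fin n → Fin 2)} (h : node S₀ 𝒯 w ∈ 𝒯) (e : Fin n → Fin 2) :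
    node S₀ 𝒯 (e :: w) = node S₀ 𝒯 w := if_pos h

lemma node_cons_of_notMem {w : List (Fin n → Fin 2)} (h : node S₀ 𝒯 w ∉ 𝒯) (e : Fin n → Fin 2) :
    node S₀ 𝒯 (e :: w) = (node S₀ 𝒯 w).child e := if_neg h

lemma notMem_of_mem_nonterminalCubes {Q : DyadicCube n} (hQ : Q ∈ nonterminalCubes S₀ 𝒯) :
    Q ∉ 𝒯 := fun h => hQ.2 Q h le_rfl

lemma node_cons_le (e : Fin n → Fin 2) (w : List (Fin n → Fin 2)) :
    node S₀ 𝒯 (e :: w) ≤ node S₀ 𝒯 w := by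
  by_cases h : node S₀ 𝒯 w ∈ 𝒯
  · rw [node_cons_of_mem h]
  · rw [node_cons_of_notMem h]; exact child_le _ _

lemma node_le (w : List (Fin n → Fin 2)) : node S₀ 𝒯 w ≤ S₀ := by
  induction w with
  | nil => exact le_rfl
  | cons e w ih => exact (node_cons_le e w).trans ih

lemma nonterminal_of_cons {e : Fin n → Fin 2} {w : List (Fin n → Fin 2)}
    (h : node S₀ 𝒯 (e :: w) ∈ nonterminalCubes S₀ 𝒯) :
    node S₀ 𝒯 w ∈ nonterminalCubes S₀ 𝒯 :=
  mem_nonterminalCubes_of_le h (node_cons_le e w) (node_le w)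

lemma node_mem_or (hn : 1 ≤ n) (hS : S₀ ∈ nonterminalCubes S₀ 𝒯) (w : List (Fin n → Fin 2)) :
    node S₀ 𝒯 w ∈ 𝒯 ∨ node S₀ 𝒯 w ∈ nonterminalCubes S₀ 𝒯 := by
  induction w with
  | nil => exact Or.inr hS
  | cons e w ih =>
    rcases ih with h | h
    · rw [node_cons_of_mem h]; exact Or.inl h
    · rw [node_cons_of_notMem (notMem_of_mem_nonterminalCubes h)]
      exact child_mem_or hn h e

lemma scale_node {w : List (Fin n → Fin 2)} (h : node S₀ 𝒯 w ∈ nonterminalCubes S₀ 𝒯) :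
    (node S₀ 𝒯 w).scale = S₀.scale + w.length := by
  induction w with
  | nil => simp [node]
  | cons e w ih =>
    have h1 := nonterminal_of_cons h
    rw [node_cons_of_notMem (notMem_of_mem_nonterminalCubes h1), List.length_cons]
    change (node S₀ 𝒯 w).scale + 1 = _
    rw [ih h1]
    push_cast
    ring

open scoped BigOperators in
lemma expect_average_node {𝕜 : Type*} [RCLike 𝕜] {ψ : (Fin n → ℝ) → 𝕜}
    (hψ : IntegrableOn ψ S₀.toSet) (w : List (Fin n → Fin 2)) :
    𝔼 e, ⨍ x in (node S₀ 𝒯 (e :: w)).toSet, ψ x = ⨍ x in (node S₀ 𝒯 w).toSet, ψ x := by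
  by_cases h : node S₀ 𝒯 w ∈ 𝒯
  · simp only [node_cons_of_mem h, Fintype.expect_const]
  · simp only [node_cons_of_notMem h]
    exact expect_average_child _ (hψ.mono_set (node_le w))

end Nodes

/-! ### Transforms of twisted martingale differences over finitely many cubes -/

section Finite

open DyadicCube

variable {n : ℕ} {𝕜 : Type*} [RCLike 𝕜]

lemma add_rpow_le {p x y : ℝ} (hp : 0 ≤ p) (hx : 0 ≤ x) (hy : 0 ≤ y) :
    (x + y) ^ p ≤ 2 ^ p * (x ^ p + y ^ p) := by
  have h1 : x + y ≤ 2 * max x y := by linarith [le_max_left x y, le_max_right x y]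
  calc (x + y) ^ p ≤ (2 * max x y) ^ p := Real.rpow_le_rpow (by positivity) h1 hp
    _ = 2 ^ p * (max x y) ^ p := Real.mul_rpow (by norm_num) (le_max_of_le_left hx)
    _ ≤ _ := by
      gcongr
      rcases max_cases x y with ⟨h, _⟩ | ⟨h, _⟩ <;> rw [h]
      · exact le_add_of_nonneg_right (by positivity)
      · exact le_add_of_nonneg_left (by positivity)

lemma MeasureTheory.MemLp.integrable_norm_rpow_ofReal {f : (Fin n → ℝ) → 𝕜} {p : ℝ} (hp : 1 < p)
    (hf : MemLp f (ENNReal.ofReal p) volume) : Integrable fun x => ‖f x‖ ^ p := by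
  have := hf.integrable_norm_rpow (by simpa using by linarith) ENNReal.ofReal_ne_top
  rwa [ENNReal.toReal_ofReal (by linarith)] at this

lemma MeasureTheory.MemLp.integrableOn_cube {f : (Fin n → ℝ) → 𝕜} {p : ℝ} (hp : 1 < p)
    (hf : MemLp f (ENNReal.ofReal p) volume) (Q : DyadicCube n) : IntegrableOn f Q.toSet := by
  have : IsFiniteMeasure (volume.restrict Q.toSet) := ⟨by
    rw [Measure.restrict_apply_univ]; exact Q.volume_ne_top.lt_top⟩
  exact (hf.restrict Q.toSet).integrable (by
    rw [← ENNReal.ofReal_one]; exact ENNReal.ofReal_le_ofReal hp.le)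

lemma eLpNorm_eq_ofReal_integral {f : (Fin n → ℝ) → 𝕜} {p : ℝ} (hp : 1 < p)
    (hf : MemLp f (ENNReal.ofReal p) volume) :
    eLpNorm f (ENNReal.ofReal p) volume = ENNReal.ofReal ((∫ x, ‖f x‖ ^ p) ^ p⁻¹) := by
  have := hf.eLpNorm_eq_integral_rpow_norm (by simpa using by linarith) ENNReal.ofReal_ne_top
  rwa [ENNReal.toReal_ofReal (by linarith)] at this

lemma integral_eq_volume_mul_average (Q : DyadicCube n) {F : Type*} [RCLike F]
    (ψ : (Fin n → ℝ) → F) :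
    ∫ x in Q.toSet, ψ x = (volume.real Q.toSet : F) * ⨍ x in Q.toSet, ψ x := by
  have := Q.volumeReal_pos.ne'
  rw [setAverage_eq, RCLike.real_smul_eq_coe_mul, ← mul_assoc, ← RCLike.ofReal_mul,
    mul_inv_cancel₀ this]
  simp

namespace IsAccretiveOn

variable {p : ℝ} {A : ℝ≥0} {Q : DyadicCube n} {b : (Fin n → ℝ) → 𝕜}

lemma average_eq_one (h : IsAccretiveOn p A Q b) : ⨍ x in Q.toSet, b x = 1 := by
  have h1 : ∫ x in Q.toSet, b x = ∫ x, b x := setIntegral_eq_integral_of_ae_compl_eq_zero h.support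
  rw [setAverage_eq, h1, h.integral_eq, RCLike.real_smul_eq_coe_mul, ← RCLike.ofReal_mul,
    inv_mul_cancel₀ Q.volumeReal_pos.ne', RCLike.ofReal_one]

lemma average_norm_rpow_le (hp : 1 < p) (h : IsAccretiveOn p A Q b) :
    ⨍ x in Q.toSet, ‖b x‖ ^ p ≤ (A : ℝ) ^ p := by
  have hp0 : 0 < p := by linarith
  have hI : 0 ≤ ∫ x, ‖b x‖ ^ p := integral_nonneg fun x => by positivity
  have h1 := h.eLpNorm_le
  rw [eLpNorm_eq_ofReal_integral hp h.memLp] at h1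
  have h2 := ENNReal.toReal_mono (by
    refine ENNReal.mul_ne_top ENNReal.coe_ne_top ?_
    exact ENNReal.rpow_ne_top_of_nonneg (by positivity) Q.volume_ne_top) h1
  rw [ENNReal.toReal_ofReal (by positivity), ENNReal.toReal_mul, ← ENNReal.toReal_rpow] at h2
  have h3 := Real.rpow_le_rpow (by positivity) h2 hp0.le
  rw [← Real.rpow_mul hI, inv_mul_cancel₀ hp0.ne', Real.rpow_one,
    Real.mul_rpow (by positivity) (by positivity), ← Real.rpow_mul (by positivity),
    one_div_mul_cancel hp0.ne', Real.rpow_one] at h3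
  have h4 : ∫ x in Q.toSet, ‖b x‖ ^ p ≤ ∫ x, ‖b x‖ ^ p :=
    setIntegral_le_integral (h.memLp.integrable_norm_rpow_ofReal hp)
      (Eventually.of_forall fun x => by positivity)
  rw [setAverage_eq, smul_eq_mul, inv_mul_le_iff₀ Q.volumeReal_pos, mul_comm]
  exact h4.trans h3

end IsAccretiveOn

section Averages

variable {p : ℝ} {A : ℝ≥0} {δ : ℝ} {b : (Fin n → ℝ) → 𝕜} {S₀ : DyadicCube n}
  {𝒯 : Set (DyadicCube n)}

lemma le_norm_average (hn : 1 ≤ n) (h𝒯 : IsTerminalFamily p A δ b S₀ 𝒯) {Q : DyadicCube n}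
    (hQ : Q ∈ nonterminalCubes S₀ 𝒯) : δ ≤ ‖⨍ x in Q.toSet, b x‖ := by
  have h := not_or.1 (not_stoppingCondition hn h𝒯 hQ)
  have h1 := not_le.1 h.1
  rw [setAverage_eq, norm_smul, Real.norm_of_nonneg (by positivity), ← div_eq_inv_mul,
    le_div_iff₀ Q.volumeReal_pos]
  exact h1.le

lemma setIntegral_norm_rpow_le (hn : 1 ≤ n) (h𝒯 : IsTerminalFamily p A δ b S₀ 𝒯)
    {Q : DyadicCube n} (hQ : Q ∈ nonterminalCubes S₀ 𝒯) :
    ∫ x in Q.toSet, ‖b x‖ ^ p ≤ δ⁻¹ * (A : ℝ) ^ p * volume.real Q.toSet :=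
  (not_le.1 (not_or.1 (not_stoppingCondition hn h𝒯 hQ)).2).le

/-- The local `L^p` averages of `b` are bounded on all nodes. For a terminal cube this comes from
its dyadic parent. -/
lemma average_norm_rpow_node_le (hn : 1 ≤ n) (hp : 1 < p) (hδ : 0 < δ)
    (hb : MemLp b (ENNReal.ofReal p) volume) (h𝒯 : IsTerminalFamily p A δ b S₀ 𝒯)
    (hS : S₀ ∈ nonterminalCubes S₀ 𝒯) (w : List (Fin n → Fin 2)) :
    ⨍ x in (node S₀ 𝒯 w).toSet, ‖b x‖ ^ p ≤ 2 ^ n * (δ⁻¹ * (A : ℝ) ^ p) := by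
  have hK : 0 ≤ δ⁻¹ * (A : ℝ) ^ p := by positivity
  have hint := hb.integrable_norm_rpow_ofReal hp
  induction w with
  | nil =>
    have := setIntegral_norm_rpow_le hn h𝒯 hS
    rw [setAverage_eq, smul_eq_mul]
    rw [inv_mul_le_iff₀ (volumeReal_pos _), mul_comm]
    refine this.trans (mul_le_mul_of_nonneg_right ?_ (volumeReal_pos _).le)
    exact le_mul_of_one_le_left hK (one_le_pow₀ (by norm_num))
  | cons e w ih =>
    rcases node_mem_or hn hS w with h | h
    · rwa [node_cons_of_mem h]
    · rw [node_cons_of_notMem (notMem_of_mem_nonterminalCubes h)]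
      have h1 := setIntegral_norm_rpow_le hn h𝒯 h
      have h2 : ∫ x in ((node S₀ 𝒯 w).child e).toSet, ‖b x‖ ^ p ≤
          ∫ x in (node S₀ 𝒯 w).toSet, ‖b x‖ ^ p :=
        setIntegral_mono_set hint.integrableOn (Eventually.of_forall fun x => by positivity)
          (Eventually.of_forall fun x hx => child_le _ e hx)
      rw [volumeReal_eq_two_pow_mul_child _ e] at h1
      rw [setAverage_eq, smul_eq_mul, inv_mul_le_iff₀ (volumeReal_pos _)]
      linarith

end Averages

section TwistedDiff

variable {b f : (Fin n → ℝ) → 𝕜} {𝒯 : Set (DyadicCube n)} {bT : DyadicCube n → (Fin n → ℝ) → 𝕜}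

lemma twistedDiff_of_notMem {Q : DyadicCube n} {x : Fin n → ℝ} (hx : x ∉ Q.toSet) :
    twistedDiff b 𝒯 bT Q f x = 0 :=
  Finset.sum_eq_zero fun e _ => Set.indicator_of_notMem (fun h => hx (Q.child_le e h)) _

lemma twistedDiff_of_mem_child {Q : DyadicCube n} {e : Fin n → Fin 2} {x : Fin n → ℝ}
    (hx : x ∈ (Q.child e).toSet) :
    twistedDiff b 𝒯 bT Q f x =
      (⨍ z in (Q.child e).toSet, f z) / (⨍ z in (Q.child e).toSet, childFun b 𝒯 bT (Q.child e) z)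
        * childFun b 𝒯 bT (Q.child e) x - (⨍ z in Q.toSet, f z) / (⨍ z in Q.toSet, b z) * b x := by
  rw [twistedDiff, Finset.sum_eq_single e]
  · rw [Set.indicator_of_mem hx]
  · intro e' _ hne
    exact Set.indicator_of_notMem
      (fun h => Set.disjoint_left.1 (Q.pairwise_disjoint_child hne) h hx) _
  · exact fun h => absurd (Finset.mem_univ e) h

lemma memLp_twistedDiff {p : ℝ≥0∞} (hb : MemLp b p volume)
    (hbT : ∀ T ∈ 𝒯, MemLp (bT T) p volume) (Q : DyadicCube n) :
    MemLp (twistedDiff b 𝒯 bT Q f) p volume := by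
  have hc : ∀ R, MemLp (childFun b 𝒯 bT R) p volume := by
    intro R
    unfold childFun
    split_ifs with h
    · exact hbT R h
    · exact hb
  exact memLp_finsetSum _ fun e _ =>
    (((hc _).const_mul _).sub (hb.const_mul _)).indicator (measurableSet_toSet _)

end TwistedDiff

open Classical in
/-- The coefficient of `b` at a node in the partial sum of the twisted differences: the transform,
with multipliers `η`, of the increments of `⟨f⟩ / ⟨b⟩` along nonterminal cubes. -/
noncomputable def twistedCoeff (f b : (Fin n → ℝ) → 𝕜) (S₀ : DyadicCube n)
    (𝒯 : Set (DyadicCube n)) (η : DyadicCube n → 𝕜) : List (Fin n → Fin 2) → 𝕜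
  | [] => 0
  | e :: w => twistedCoeff f b S₀ 𝒯 η w +
      if node S₀ 𝒯 (e :: w) ∈ nonterminalCubes S₀ 𝒯 then
        η (node S₀ 𝒯 w) *
          ((⨍ z in (node S₀ 𝒯 (e :: w)).toSet, f z) / (⨍ z in (node S₀ 𝒯 (e :: w)).toSet, b z)
            - (⨍ z in (node S₀ 𝒯 w).toSet, f z) / (⨍ z in (node S₀ 𝒯 w).toSet, b z))
      else 0

section PartialSum

variable {p : ℝ} {A : ℝ≥0} {δ : ℝ} {b f : (Fin n → ℝ) → 𝕜} {S₀ : DyadicCube n}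
  {𝒯 : Set (DyadicCube n)} {bT : DyadicCube n → (Fin n → ℝ) → 𝕜} {η : DyadicCube n → 𝕜}
  {F : Finset (DyadicCube n)}

/-- Passing from a cube to its child adds one term to the sum over the larger cubes. -/
lemma sum_scale_lt_child (hη : ∀ Q ∉ F, η Q = 0) {Q : DyadicCube n} {e : Fin n → Fin 2}
    {x : Fin n → ℝ} (hx : x ∈ (Q.child e).toSet) :
    (∑ R ∈ F, if R.scale < (Q.child e).scale then η R * twistedDiff b 𝒯 bT R f x else 0) =
      (∑ R ∈ F, if R.scale < Q.scale then η R * twistedDiff b 𝒯 bT R f x else 0) +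
        η Q * twistedDiff b 𝒯 bT Q f x := by
  classical
  have h1 : ∀ R : DyadicCube n,
      (if R.scale < (Q.child e).scale then η R * twistedDiff b 𝒯 bT R f x else 0) =
      (if R.scale < Q.scale then η R * twistedDiff b 𝒯 bT R f x else 0) +
        if Q = R then η R * twistedDiff b 𝒯 bT R f x else 0 := by
    intro R
    have hs : (Q.child e).scale = Q.scale + 1 := rfl
    rw [hs]
    rcases lt_trichotomy R.scale Q.scale with h | h | h
    · have hne : Q ≠ R := by rintro rfl; exact lt_irrefl _ h
      rw [if_pos (by omega), if_pos h, if_neg hne, add_zero]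
    · rw [if_pos (by omega), if_neg (by omega), zero_add]
      split_ifs with hne
      · rfl
      · rw [twistedDiff_of_notMem, mul_zero]
        exact fun hR => hne (eq_of_mem h.symm (Q.child_le e hx) hR)
    · have hne : Q ≠ R := by rintro rfl; exact lt_irrefl _ h
      rw [if_neg (by omega), if_neg (by omega), if_neg hne, add_zero]
  simp only [h1]
  rw [Finset.sum_add_distrib, Finset.sum_ite_eq]
  congr 1
  split_ifs with h
  · rfl
  · rw [hη Q h, zero_mul]

lemma sum_scale_lt_node_of_nonterminal (hF : ∀ Q ∈ F, Q ∈ nonterminalCubes S₀ 𝒯)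
    (hn : 1 ≤ n) (hη : ∀ Q ∉ F, η Q = 0)
    {w : List (Fin n → Fin 2)} (hw : node S₀ 𝒯 w ∈ nonterminalCubes S₀ 𝒯) {x : Fin n → ℝ}
    (hx : x ∈ (node S₀ 𝒯 w).toSet) :
    (∑ R ∈ F, if R.scale < (node S₀ 𝒯 w).scale then η R * twistedDiff b 𝒯 bT R f x else 0) =
      twistedCoeff f b S₀ 𝒯 η w * b x := by
  induction w with
  | nil =>
    rw [twistedCoeff, zero_mul]
    refine Finset.sum_eq_zero fun R hR => if_neg ?_
    exact not_lt.2 (scale_le_of_le hn (hF R hR).1)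
  | cons e w ih =>
    have hw' := nonterminal_of_cons hw
    have hnode := node_cons_of_notMem (notMem_of_mem_nonterminalCubes hw') e
    have hx' := hx
    rw [hnode] at hx'
    have hch : (node S₀ 𝒯 w).child e ∉ 𝒯 := by
      rw [← hnode]; exact notMem_of_mem_nonterminalCubes hw
    rw [twistedCoeff, if_pos hw, hnode, sum_scale_lt_child hη hx', ih hw' (child_le _ e hx'),
      twistedDiff_of_mem_child hx']
    simp only [childFun, if_neg hch]
    ring

/-- On a terminal cube the sum of all twisted differences is a combination of `b` and `b_T`. -/
lemma sum_scale_lt_node_of_terminal (hF : ∀ Q ∈ F, Q ∈ nonterminalCubes S₀ 𝒯)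
    (hn : 1 ≤ n) (hδ : 0 < δ) (hη : ∀ Q ∉ F, η Q = 0) (hη1 : ∀ Q, ‖η Q‖ ≤ 1)
    (hS : S₀ ∈ nonterminalCubes S₀ 𝒯)
    (hbδ : ∀ Q ∈ nonterminalCubes S₀ 𝒯, δ ≤ ‖⨍ x in Q.toSet, b x‖)
    (hbT : ∀ T ∈ 𝒯, ⨍ x in T.toSet, bT T x = 1)
    {w : List (Fin n → Fin 2)} (hw : node S₀ 𝒯 w ∈ 𝒯) :
    ∃ c₁ c₂ : 𝕜,
      (∀ x ∈ (node S₀ 𝒯 w).toSet,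
        (∑ R ∈ F, if R.scale < (node S₀ 𝒯 w).scale then η R * twistedDiff b 𝒯 bT R f x else 0) =
          c₁ * b x + c₂ * bT (node S₀ 𝒯 w) x) ∧
      ‖c₁‖ ≤ ‖twistedCoeff f b S₀ 𝒯 η w‖ +
        δ⁻¹ * runMax (fun v => ⨍ z in (node S₀ 𝒯 v).toSet, ‖f z‖) w ∧
      ‖c₂‖ ≤ runMax (fun v => ⨍ z in (node S₀ 𝒯 v).toSet, ‖f z‖) w := by
  set a : List (Fin n → Fin 2) → ℝ := fun v => ⨍ z in (node S₀ 𝒯 v).toSet, ‖f z‖ with ha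
  have hfa : ∀ v, ‖⨍ z in (node S₀ 𝒯 v).toSet, f z‖ ≤ runMax a v := fun v =>
    (norm_average_le _ _).trans (le_runMax a v)
  induction w with
  | nil => exact absurd hw (notMem_of_mem_nonterminalCubes hS)
  | cons e w ih =>
    have hcoeff : twistedCoeff f b S₀ 𝒯 η (e :: w) = twistedCoeff f b S₀ 𝒯 η w := by
      rw [twistedCoeff, if_neg fun h => notMem_of_mem_nonterminalCubes h hw, add_zero]
    rw [hcoeff]
    rcases node_mem_or hn hS w with h | h
    · obtain ⟨c₁, c₂, h1, h2, h3⟩ := ih h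
      refine ⟨c₁, c₂, ?_, h2.trans ?_, h3.trans (runMax_le_cons a e w)⟩
      · rwa [node_cons_of_mem h]
      · gcongr
        exact runMax_le_cons a e w
    · have hnode := node_cons_of_notMem (notMem_of_mem_nonterminalCubes h) e
      have hch : (node S₀ 𝒯 w).child e ∈ 𝒯 := by rwa [← hnode]
      refine ⟨twistedCoeff f b S₀ 𝒯 η w - η (node S₀ 𝒯 w) *
        ((⨍ z in (node S₀ 𝒯 w).toSet, f z) / (⨍ z in (node S₀ 𝒯 w).toSet, b z)),
        η (node S₀ 𝒯 w) * ⨍ z in (node S₀ 𝒯 (e :: w)).toSet, f z, fun x hx => ?_, ?_, ?_⟩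
      · rw [hnode] at hx ⊢
        rw [sum_scale_lt_child hη hx,
          sum_scale_lt_node_of_nonterminal hF hn hη h (child_le _ e hx),
          twistedDiff_of_mem_child hx]
        simp only [childFun, if_pos hch, hbT _ hch, div_one]
        ring
      · refine (norm_sub_le _ _).trans (add_le_add_right ?_ _)
        rw [norm_mul, norm_div, div_eq_inv_mul]
        calc ‖η (node S₀ 𝒯 w)‖ * (‖⨍ z in (node S₀ 𝒯 w).toSet, b z‖⁻¹ *
              ‖⨍ z in (node S₀ 𝒯 w).toSet, f z‖) ≤ 1 * (δ⁻¹ * runMax a (e :: w)) := by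
              gcongr
              · exact hη1 _
              · exact hbδ _ h
              · exact (hfa w).trans (runMax_le_cons a e w)
          _ = _ := one_mul _
      · rw [norm_mul]
        calc _ ≤ 1 * runMax a (e :: w) := by
              gcongr
              · exact hη1 _
              · exact hfa _
          _ = _ := one_mul _

/-- On a node of a generation below all cubes of `F`, restricting the sum to cubes larger than the
node changes nothing. -/
lemma sum_scale_lt_eq_sum (hF : ∀ Q ∈ F, Q ∈ nonterminalCubes S₀ 𝒯) (hn : 1 ≤ n)
    (hS : S₀ ∈ nonterminalCubes S₀ 𝒯) {w : List (Fin n → Fin 2)}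
    (hw : ∀ Q ∈ F, Q.scale < S₀.scale + w.length) {x : Fin n → ℝ}
    (hx : x ∈ (node S₀ 𝒯 w).toSet) :
    (∑ R ∈ F, if R.scale < (node S₀ 𝒯 w).scale then η R * twistedDiff b 𝒯 bT R f x else 0) =
      ∑ R ∈ F, η R * twistedDiff b 𝒯 bT R f x := by
  refine Finset.sum_congr rfl fun R hR => ?_
  split_ifs with h
  · rfl
  · rcases node_mem_or hn hS w with hT | hnt
    · rw [twistedDiff_of_notMem, mul_zero]
      exact fun hxR => (hF R hR).2 _ hT (le_of_mem (not_lt.1 h) hxR hx)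
    · rw [scale_node hnt] at h
      exact absurd (hw R hR) h

lemma average_mono {Q : DyadicCube n} {u v : (Fin n → ℝ) → ℝ} (hu : IntegrableOn u Q.toSet)
    (hv : IntegrableOn v Q.toSet) (h : ∀ x ∈ Q.toSet, u x ≤ v x) :
    ⨍ x in Q.toSet, u x ≤ ⨍ x in Q.toSet, v x := by
  rw [setAverage_eq, setAverage_eq, smul_eq_mul, smul_eq_mul]
  exact mul_le_mul_of_nonneg_left (setIntegral_mono_on hu hv Q.measurableSet_toSet h)
    (by positivity)

lemma average_nonneg (Q : DyadicCube n) {u : (Fin n → ℝ) → ℝ} (hu : ∀ x, 0 ≤ u x) :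
    0 ≤ ⨍ x in Q.toSet, u x := by
  rw [setAverage_eq]
  exact smul_nonneg (by positivity) (integral_nonneg hu)

lemma average_const_mul (Q : DyadicCube n) (c : ℝ) (u : (Fin n → ℝ) → ℝ) :
    ⨍ x in Q.toSet, c * u x = c * ⨍ x in Q.toSet, u x := by
  rw [setAverage_eq, setAverage_eq, smul_eq_mul, smul_eq_mul, integral_const_mul]
  ring

lemma average_add (Q : DyadicCube n) {u v : (Fin n → ℝ) → ℝ} (hu : IntegrableOn u Q.toSet)
    (hv : IntegrableOn v Q.toSet) :
    ⨍ x in Q.toSet, (u x + v x) = (⨍ x in Q.toSet, u x) + ⨍ x in Q.toSet, v x := by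
  rw [setAverage_eq, setAverage_eq, setAverage_eq, integral_add hu hv, smul_add]

/-- The local `L^p` average over a node of the last generation is controlled by the coefficient of
`b` and the running maximum of the averages of `f`. -/
lemma average_norm_sum_rpow_le (hn : 1 ≤ n) (hp : 1 < p) (hδ : 0 < δ)
    (hF : ∀ Q ∈ F, Q ∈ nonterminalCubes S₀ 𝒯) (hη : ∀ Q ∉ F, η Q = 0) (hη1 : ∀ Q, ‖η Q‖ ≤ 1)
    (hS : S₀ ∈ nonterminalCubes S₀ 𝒯) (hb : IsAccretiveOn p A S₀ b)
    (h𝒯 : IsTerminalFamily p A δ b S₀ 𝒯) (hbT : ∀ T ∈ 𝒯, IsAccretiveOn p A T (bT T))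
    {w : List (Fin n → Fin 2)} (hw : ∀ Q ∈ F, Q.scale < S₀.scale + w.length) :
    ⨍ x in (node S₀ 𝒯 w).toSet, ‖∑ Q ∈ F, η Q * twistedDiff b 𝒯 bT Q f x‖ ^ p ≤
      2 ^ p * (2 ^ p * (1 + δ⁻¹ ^ p) * (2 ^ n * (δ⁻¹ * (A : ℝ) ^ p)) + (A : ℝ) ^ p) *
        (‖twistedCoeff f b S₀ 𝒯 η w‖ ^ p +
          runMax (fun v => ⨍ z in (node S₀ 𝒯 v).toSet, ‖f z‖) w ^ p) := by
  have hp0 : 0 < p := by linarith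
  set K : ℝ := 2 ^ n * (δ⁻¹ * (A : ℝ) ^ p) with hK
  set H := ‖twistedCoeff f b S₀ 𝒯 η w‖ with hH
  set M := runMax (fun v => ⨍ z in (node S₀ 𝒯 v).toSet, ‖f z‖) w with hM
  have hM0 : 0 ≤ M := (norm_nonneg _).trans ((norm_average_le _ f).trans
    (le_runMax (fun v => ⨍ z in (node S₀ 𝒯 v).toSet, ‖f z‖) w))
  have hH0 : 0 ≤ H := norm_nonneg _
  have hbK := average_norm_rpow_node_le hn hp hδ hb.memLp h𝒯 hS w
  have hbδ : ∀ Q ∈ nonterminalCubes S₀ 𝒯, δ ≤ ‖⨍ x in Q.toSet, b x‖ := fun Q hQ =>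
    le_norm_average hn h𝒯 hQ
  have hbi := (hb.memLp.integrable_norm_rpow_ofReal hp).integrableOn (s := (node S₀ 𝒯 w).toSet)
  have hsum : MemLp (fun x => ∑ Q ∈ F, η Q * twistedDiff b 𝒯 bT Q f x)
      (ENNReal.ofReal p) volume :=
    memLp_finsetSum _ fun Q _ =>
      (memLp_twistedDiff hb.memLp (fun T hT => (hbT T hT).memLp) Q).const_mul _
  have hsi := (hsum.integrable_norm_rpow_ofReal hp).integrableOn (s := (node S₀ 𝒯 w).toSet)
  have hHp : 0 ≤ H ^ p := by positivity
  have hMp : 0 ≤ M ^ p := by positivity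
  have h2p : (1 : ℝ) ≤ 2 ^ p := Real.one_le_rpow (by norm_num) hp0.le
  have hδp : 0 ≤ δ⁻¹ ^ p := by positivity
  have hK0 : 0 ≤ K := by positivity
  have hA0 : 0 ≤ (A : ℝ) ^ p := by positivity
  rcases node_mem_or hn hS w with hT | hnt
  · obtain ⟨c₁, c₂, h1, h2, h3⟩ := sum_scale_lt_node_of_terminal (f := f) hF hn hδ hη hη1 hS hbδ
      (fun T hT => (hbT T hT).average_eq_one) hT
    have hTi := ((hbT _ hT).memLp.integrable_norm_rpow_ofReal hp).integrableOn
      (s := (node S₀ 𝒯 w).toSet)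
    have hTA := (hbT _ hT).average_norm_rpow_le hp
    have hc1 : ‖c₁‖ ^ p ≤ 2 ^ p * (H ^ p + δ⁻¹ ^ p * M ^ p) := by
      refine (Real.rpow_le_rpow (norm_nonneg _) h2 hp0.le).trans ?_
      refine (add_rpow_le hp0.le hH0 (by positivity)).trans ?_
      rw [Real.mul_rpow (by positivity) hM0]
    have hc2 : ‖c₂‖ ^ p ≤ M ^ p := Real.rpow_le_rpow (norm_nonneg _) h3 hp0.le
    calc ⨍ x in (node S₀ 𝒯 w).toSet, ‖∑ Q ∈ F, η Q * twistedDiff b 𝒯 bT Q f x‖ ^ p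
        ≤ ⨍ x in (node S₀ 𝒯 w).toSet, 2 ^ p * (‖c₁‖ ^ p * ‖b x‖ ^ p +
            ‖c₂‖ ^ p * ‖bT (node S₀ 𝒯 w) x‖ ^ p) := by
          refine average_mono hsi (((hbi.const_mul _).add (hTi.const_mul _)).const_mul _)
            fun x hx => ?_
          rw [← sum_scale_lt_eq_sum hF hn hS hw hx, h1 x hx, ← Real.mul_rpow (norm_nonneg _)
            (norm_nonneg _), ← Real.mul_rpow (norm_nonneg _) (norm_nonneg _), ← norm_mul,
            ← norm_mul]
          exact (Real.rpow_le_rpow (norm_nonneg _) (norm_add_le _ _) hp0.le).trans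
            (add_rpow_le hp0.le (norm_nonneg _) (norm_nonneg _))
      _ = 2 ^ p * (‖c₁‖ ^ p * (⨍ x in (node S₀ 𝒯 w).toSet, ‖b x‖ ^ p) +
            ‖c₂‖ ^ p * ⨍ x in (node S₀ 𝒯 w).toSet, ‖bT (node S₀ 𝒯 w) x‖ ^ p) := by
          rw [average_const_mul, average_add _ (hbi.const_mul _) (hTi.const_mul _),
            average_const_mul, average_const_mul]
      _ ≤ 2 ^ p * (2 ^ p * (H ^ p + δ⁻¹ ^ p * M ^ p) * K + M ^ p * (A : ℝ) ^ p) := by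
          have n1 := average_nonneg (node S₀ 𝒯 w) fun x => Real.rpow_nonneg (norm_nonneg (b x)) p
          have n2 := average_nonneg (node S₀ 𝒯 w) fun x =>
            Real.rpow_nonneg (norm_nonneg (bT (node S₀ 𝒯 w) x)) p
          gcongr
      _ ≤ 2 ^ p * ((2 ^ p * (1 + δ⁻¹ ^ p) * K + (A : ℝ) ^ p) * (H ^ p + M ^ p)) := by
          refine mul_le_mul_of_nonneg_left ?_ (by positivity)
          have e1 : 0 ≤ 2 ^ p * K * (M ^ p + δ⁻¹ ^ p * H ^ p) := by positivity
          have e2 : 0 ≤ (A : ℝ) ^ p * H ^ p := by positivity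
          linarith
      _ = _ := by ring
  · calc ⨍ x in (node S₀ 𝒯 w).toSet, ‖∑ Q ∈ F, η Q * twistedDiff b 𝒯 bT Q f x‖ ^ p
        ≤ ⨍ x in (node S₀ 𝒯 w).toSet, H ^ p * ‖b x‖ ^ p := by
          refine average_mono hsi (hbi.const_mul _) fun x hx => le_of_eq ?_
          rw [← sum_scale_lt_eq_sum hF hn hS hw hx,
            sum_scale_lt_node_of_nonterminal hF hn hη hnt hx, norm_mul,
            Real.mul_rpow (norm_nonneg _) (norm_nonneg _)]
      _ = H ^ p * ⨍ x in (node S₀ 𝒯 w).toSet, ‖b x‖ ^ p := average_const_mul _ _ _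
      _ ≤ K * (H ^ p + M ^ p) := by
          have := mul_le_mul_of_nonneg_left hbK hHp
          nlinarith [mul_nonneg hK0 hMp]
      _ ≤ _ := by
          refine mul_le_mul_of_nonneg_right ?_ (by positivity)
          have e1 : K ≤ 2 ^ p * K := le_mul_of_one_le_left hK0 h2p
          have e2 : 2 ^ p * K ≤ 2 ^ p * (1 + δ⁻¹ ^ p) * K := by
            refine mul_le_mul_of_nonneg_right ?_ hK0
            nlinarith
          have e3 : (0 : ℝ) ≤ 2 ^ p * (1 + δ⁻¹ ^ p) * K + (A : ℝ) ^ p := by positivity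
          have e4 := le_mul_of_one_le_left e3 h2p
          linarith

end PartialSum

end Finite

section FiniteBound

open DyadicCube

/-- The uniform `L^p` bound for finite sums of twisted martingale differences. -/
lemma exists_finite_sum_bound (𝕜 : Type*) [RCLike 𝕜] {n : ℕ} (hn : 1 ≤ n) {p : ℝ} (hp : 1 < p)
    (A : ℝ≥0) {δ : ℝ} (hδ : 0 < δ) :
    ∃ C : ℝ, 0 ≤ C ∧ ∀ (S₀ : DyadicCube n) (b : (Fin n → ℝ) → 𝕜), IsAccretiveOn p A S₀ b →
      ∀ (𝒯 : Set (DyadicCube n)), IsTerminalFamily p A δ b S₀ 𝒯 →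
      ∀ (bT : DyadicCube n → (Fin n → ℝ) → 𝕜), (∀ T ∈ 𝒯, IsAccretiveOn p A T (bT T)) →
      ∀ (η : DyadicCube n → 𝕜), (∀ Q, ‖η Q‖ ≤ 1) →
      ∀ (F : Finset (DyadicCube n)), (∀ Q ∈ F, Q ∈ nonterminalCubes S₀ 𝒯) →
      (∀ Q ∉ F, η Q = 0) →
      ∀ (f : (Fin n → ℝ) → 𝕜), MemLp f (ENNReal.ofReal p) volume →
        ∫ x, ‖∑ Q ∈ F, η Q * twistedDiff b 𝒯 bT Q f x‖ ^ p ≤ C * ∫ x, ‖f x‖ ^ p := by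
  classical
  have hp0 : 0 < p := by linarith
  set K : ℝ := 2 ^ n * (δ⁻¹ * (A : ℝ) ^ p) with hK
  have hK0 : 0 ≤ K := by positivity
  set C₁ : ℝ := 2 ^ p * (2 ^ p * (1 + δ⁻¹ ^ p) * K + (A : ℝ) ^ p) with hC₁
  have hC₁0 : 0 ≤ C₁ := by positivity
  obtain ⟨C₂, hC₂, H⟩ := exists_transform_bound (E := Fin n → Fin 2) (𝕜 := 𝕜) (δ := δ)
    (B := K ^ (1 / p)) hp hδ (by positivity)
  refine ⟨C₁ * C₂, by positivity, ?_⟩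
  intro S₀ b hb 𝒯 h𝒯 bT hbT η hη1 F hF hη f hf
  rcases F.eq_empty_or_nonempty with rfl | ⟨Q₀, hQ₀⟩
  · simp only [Finset.sum_empty, norm_zero, Real.zero_rpow hp0.ne', integral_zero]
    exact mul_nonneg (by positivity) (integral_nonneg fun x => by positivity)
  have hS : S₀ ∈ nonterminalCubes S₀ 𝒯 :=
    mem_nonterminalCubes_of_le (hF Q₀ hQ₀) (hF Q₀ hQ₀).1 le_rfl
  -- a generation below all cubes of `F`
  obtain ⟨N, hN⟩ : ∃ N : ℕ, ∀ Q ∈ F, Q.scale < S₀.scale + N := by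
    refine ⟨F.sup fun Q => (Q.scale - S₀.scale + 1).toNat, fun Q hQ => ?_⟩
    have := Finset.le_sup (f := fun Q => (Q.scale - S₀.scale + 1).toNat) hQ
    omega
  set Φ : (Fin n → ℝ) → 𝕜 := fun x => ∑ Q ∈ F, η Q * twistedDiff b 𝒯 bT Q f x with hΦ
  have hsum : MemLp Φ (ENNReal.ofReal p) volume :=
    memLp_finsetSum _ fun Q _ =>
      (memLp_twistedDiff hb.memLp (fun T hT => (hbT T hT).memLp) Q).const_mul _
  set av : List (Fin n → Fin 2) → 𝕜 := fun w => ⨍ z in (node S₀ 𝒯 w).toSet, f z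
  set bv : List (Fin n → Fin 2) → 𝕜 := fun w => ⨍ z in (node S₀ 𝒯 w).toSet, b z
  set a : List (Fin n → Fin 2) → ℝ := fun w => ⨍ z in (node S₀ 𝒯 w).toSet, ‖f z‖ with ha
  have hbB : ∀ w, ‖bv w‖ ≤ K ^ (1 / p) := by
    intro w
    have h1 := average_norm_rpow_node_le hn hp hδ hb.memLp h𝒯 hS w
    have h2 := DyadicCube.average_norm_rpow_le (node S₀ 𝒯 w) hp.le (hb.memLp.integrableOn_cube hp _)
      (hb.memLp.integrable_norm_rpow_ofReal hp).integrableOn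
    have h3 : ‖bv w‖ ^ p ≤ K :=
      (Real.rpow_le_rpow (norm_nonneg _) (norm_average_le _ _) hp0.le).trans (h2.trans h1)
    have h4 := Real.rpow_le_rpow (by positivity) h3 (by positivity : 0 ≤ 1 / p)
    rwa [← Real.rpow_mul (norm_nonneg _), mul_one_div_cancel hp0.ne', Real.rpow_one] at h4
  have htree := H N av bv (fun w => η (node S₀ 𝒯 w)) (twistedCoeff f b S₀ 𝒯 η) a
    (fun w => node S₀ 𝒯 w ∈ nonterminalCubes S₀ 𝒯)
    (fun w _ => expect_average_node (hf.integrableOn_cube hp _) w)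
    (fun w _ => expect_average_node (hb.memLp.integrableOn_cube hp _) w)
    (fun w _ => expect_average_node (hf.integrableOn_cube hp _).norm w)
    (fun w => norm_average_le _ _) hbB (fun w hw => le_norm_average hn h𝒯 hw)
    (fun e w h => nonterminal_of_cons h) (fun w => hη1 _) rfl (fun e w => by
      rw [twistedCoeff])
  rw [← iterAvg_add] at htree
  have hleaf : iterAvg (fun w => ⨍ x in (node S₀ 𝒯 w).toSet, ‖Φ x‖ ^ p) N [] ≤
      C₁ * iterAvg (fun w => ‖twistedCoeff f b S₀ 𝒯 η w‖ ^ p + runMax a w ^ p) N [] := by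
    rw [← iterAvg_const_mul]
    refine iterAvg_mono N [] fun w hw => ?_
    refine average_norm_sum_rpow_le hn hp hδ hF hη hη1 hS hb h𝒯 hbT fun Q hQ => ?_
    have := hN Q hQ
    simp only [List.length_nil, zero_add] at hw
    rwa [hw]
  have hfleaf : iterAvg (fun w => a w ^ p) N [] ≤
      iterAvg (fun w => ⨍ x in (node S₀ 𝒯 w).toSet, ‖f x‖ ^ p) N [] :=
    iterAvg_mono N [] fun w _ => DyadicCube.average_norm_rpow_le _ hp.le
      (hf.integrableOn_cube hp _) (hf.integrable_norm_rpow_ofReal hp).integrableOn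
  rw [iterAvg_of_martingale (u := fun w => ⨍ x in (node S₀ 𝒯 w).toSet, ‖f x‖ ^ p) N []
    fun w _ => expect_average_node (hf.integrable_norm_rpow_ofReal hp).integrableOn w] at hfleaf
  rw [iterAvg_of_martingale (u := fun w => ⨍ x in (node S₀ 𝒯 w).toSet, ‖Φ x‖ ^ p) N []
    fun w _ => expect_average_node (hsum.integrable_norm_rpow_ofReal hp).integrableOn w] at hleaf
  change ⨍ x in S₀.toSet, ‖Φ x‖ ^ p ≤ _ at hleaf
  change _ ≤ ⨍ x in S₀.toSet, ‖f x‖ ^ p at hfleaf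
  have hzero : ∀ x, x ∉ S₀.toSet → ‖Φ x‖ ^ p = 0 := by
    intro x hx
    have : Φ x = 0 := Finset.sum_eq_zero fun Q hQ => by
      rw [twistedDiff_of_notMem fun h => hx ((hF Q hQ).1 h), mul_zero]
    rw [this, norm_zero, Real.zero_rpow hp0.ne']
  have hV := S₀.volumeReal_pos
  rw [← setIntegral_eq_integral_of_forall_compl_eq_zero hzero]
  have e1 := integral_eq_volume_mul_average S₀ (fun x => ‖Φ x‖ ^ p)
  have e2 := integral_eq_volume_mul_average S₀ (fun x => ‖f x‖ ^ p)
  simp only [RCLike.ofReal_real_eq_id, id_eq] at e1 e2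
  have e3 : ∫ x in S₀.toSet, ‖f x‖ ^ p ≤ ∫ x, ‖f x‖ ^ p :=
    setIntegral_le_integral (hf.integrable_norm_rpow_ofReal hp)
      (Eventually.of_forall fun x => by positivity)
  calc ∫ x in S₀.toSet, ‖Φ x‖ ^ p
      ≤ volume.real S₀.toSet * (C₁ * (C₂ * ⨍ x in S₀.toSet, ‖f x‖ ^ p)) := by
        rw [e1]
        refine mul_le_mul_of_nonneg_left (hleaf.trans ?_) hV.le
        exact mul_le_mul_of_nonneg_left
          (htree.trans (mul_le_mul_of_nonneg_left hfleaf hC₂)) hC₁0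
    _ = C₁ * C₂ * ∫ x in S₀.toSet, ‖f x‖ ^ p := by rw [e2]; ring
    _ ≤ _ := mul_le_mul_of_nonneg_left e3 (by positivity)

end FiniteBound

/-! ### The twisted martingale transform inequality -/

/-- The twisted martingale transform inequality. The series is summed unconditionally in `L^p`
(limit over finite subfamilies, to a sum `g`); `C` depends only on `𝕜`, `n`, `p`, `A`, `δ`. -/
theorem theorem2p1 {𝕜 : Type*} [RCLike 𝕜] (n : ℕ) (hn : 1 ≤ n) (p : ℝ) (hp : 1 < p)
    (A : ℝ≥0) (δ : ℝ) (hδ₀ : 0 < δ) (hδ₁ : δ < 1) :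
    ∃ C : ℝ≥0, ∀ (S₀ : DyadicCube n) (b : (Fin n → ℝ) → 𝕜), IsAccretiveOn p A S₀ b →
      ∀ (𝒯 : Set (DyadicCube n)), IsTerminalFamily p A δ b S₀ 𝒯 →
      ∀ (bT : DyadicCube n → (Fin n → ℝ) → 𝕜), (∀ T ∈ 𝒯, IsAccretiveOn p A T (bT T)) →
      ∀ (ε : DyadicCube n → 𝕜), (∀ Q ∈ nonterminalCubes S₀ 𝒯, ‖ε Q‖ ≤ 1) →
      ∀ (f : (Fin n → ℝ) → 𝕜), MemLp f (ENNReal.ofReal p) volume →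
        ∃ g : (Fin n → ℝ) → 𝕜, MemLp g (ENNReal.ofReal p) volume ∧
          Tendsto (fun F : Finset (nonterminalCubes S₀ 𝒯) =>
              eLpNorm (fun x => (∑ Q ∈ F, ε Q * twistedDiff b 𝒯 bT Q f x) - g x)
                (ENNReal.ofReal p) volume) atTop (𝓝 0) ∧
          eLpNorm g (ENNReal.ofReal p) volume ≤ C * eLpNorm f (ENNReal.ofReal p) volume := by
  classical
  have hp0 : 0 < p := by linarith
  obtain ⟨C₀, hC₀, H⟩ := exists_finite_sum_bound 𝕜 hn hp A hδ₀
  refine ⟨⟨C₀ ^ p⁻¹, by positivity⟩, ?_⟩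
  intro S₀ b hb 𝒯 h𝒯 bT hbT ε hε f hf
  have : Fact (1 ≤ ENNReal.ofReal p) := ⟨by
    rw [← ENNReal.ofReal_one]; exact ENNReal.ofReal_le_ofReal hp.le⟩
  have hmem : ∀ Q : nonterminalCubes S₀ 𝒯,
      MemLp (fun x => ε Q * twistedDiff b 𝒯 bT Q f x) (ENNReal.ofReal p) volume := fun Q =>
    (memLp_twistedDiff hb.memLp (fun T hT => (hbT T hT).memLp) Q).const_mul _
  set X : nonterminalCubes S₀ 𝒯 → Lp 𝕜 (ENNReal.ofReal p) volume := fun Q => (hmem Q).toLp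
    with hX
  have hcoe : ∀ (F : Finset (nonterminalCubes S₀ 𝒯)) (σ : nonterminalCubes S₀ 𝒯 → ℝ),
      ⇑(∑ Q ∈ F, σ Q • X Q) =ᵐ[volume]
        fun x => ∑ Q ∈ F, (σ Q : 𝕜) * (ε Q * twistedDiff b 𝒯 bT Q f x) := by
    intro F σ
    induction F using Finset.induction_on with
    | empty => simp only [Finset.sum_empty]; exact Lp.coeFn_zero _ _ _
    | insert Q F hQ ih =>
      rw [Finset.sum_insert hQ]
      filter_upwards [Lp.coeFn_add (σ Q • X Q) (∑ R ∈ F, σ R • X R), Lp.coeFn_smul (σ Q) (X Q),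
        (hmem Q).coeFn_toLp, ih] with x h1 h2 h3 h4
      rw [h1, Pi.add_apply, h2, h4, Pi.smul_apply, h3, Finset.sum_insert hQ,
        RCLike.real_smul_eq_coe_mul]
  have hbound : ∀ (F : Finset (nonterminalCubes S₀ 𝒯)) (σ : nonterminalCubes S₀ 𝒯 → ℝ),
      (∀ Q, |σ Q| ≤ 1) →
      ‖∑ Q ∈ F, σ Q • X Q‖ ≤ C₀ ^ p⁻¹ * (eLpNorm f (ENNReal.ofReal p) volume).toReal := by
    intro F σ hσ
    set η : DyadicCube n → 𝕜 := fun Q =>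
      if h : ∃ hQ : Q ∈ nonterminalCubes S₀ 𝒯, (⟨Q, hQ⟩ : nonterminalCubes S₀ 𝒯) ∈ F then
        (σ ⟨Q, h.1⟩ : 𝕜) * ε Q else 0 with hη
    have hηF : ∀ Q ∈ F, η (Q : DyadicCube n) = (σ Q : 𝕜) * ε Q := fun Q hQ =>
      dif_pos ⟨Q.2, hQ⟩
    have h1 := H S₀ b hb 𝒯 h𝒯 bT hbT η (fun Q => by
        simp only [hη]
        split_ifs with h
        · rw [norm_mul, RCLike.norm_ofReal]
          exact mul_le_one₀ (hσ _) (norm_nonneg _) (hε Q h.1)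
        · simp) (F.map (Function.Embedding.subtype _)) (fun Q hQ => by
        obtain ⟨R, _, rfl⟩ := Finset.mem_map.1 hQ
        exact R.2) (fun Q hQ => dif_neg fun h => hQ (Finset.mem_map.2 ⟨⟨Q, h.1⟩, h.2, rfl⟩)) f hf
    have h2 : ‖∑ Q ∈ F, σ Q • X Q‖ ^ p ≤ C₀ * ∫ x, ‖f x‖ ^ p := by
      rw [Lp_norm_rpow_eq hp0]
      refine le_trans (le_of_eq (integral_congr_ae ?_)) h1
      filter_upwards [hcoe F σ] with x hx
      rw [hx, Finset.sum_map]
      congr 2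
      refine Finset.sum_congr rfl fun Q hQ => ?_
      change _ = η (Q : DyadicCube n) * _
      rw [hηF Q hQ, mul_assoc]
      rfl
    have hI : 0 ≤ ∫ x, ‖f x‖ ^ p := integral_nonneg fun x => by positivity
    have h3 := Real.rpow_le_rpow (by positivity) h2 (by positivity : 0 ≤ p⁻¹)
    rw [← Real.rpow_mul (norm_nonneg _), mul_inv_cancel₀ hp0.ne', Real.rpow_one,
      Real.mul_rpow hC₀ hI] at h3
    rwa [eLpNorm_eq_ofReal_integral hp hf, ENNReal.toReal_ofReal (by positivity)]
  have hsummable : Summable X := by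
    refine summable_of_bounded_of_uniformConvex hp0
      (fun θ hθ => exists_Lp_norm_rpow_le hp hθ) X
      (C₀ ^ p⁻¹ * (eLpNorm f (ENNReal.ofReal p) volume).toReal) fun σ hσ => ?_
    rw [Finsupp.linearCombination_apply, Finsupp.sum]
    exact hbound σ.support σ hσ
  obtain ⟨g, hg⟩ := hsummable
  refine ⟨g, Lp.memLp g, ?_, ?_⟩
  · have h1 : Tendsto (fun F : Finset (nonterminalCubes S₀ 𝒯) => ‖∑ Q ∈ F, X Q - g‖ₑ)
        atTop (𝓝 0) := by
      have h2 : Tendsto (fun F : Finset (nonterminalCubes S₀ 𝒯) => ∑ Q ∈ F, X Q - g)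
          atTop (𝓝 0) := by
        simpa using Tendsto.sub_const hg g
      simpa using h2.enorm
    refine h1.congr fun F => ?_
    rw [Lp.enorm_def]
    refine eLpNorm_congr_ae ?_
    have h2 := hcoe F 1
    simp only [Pi.one_apply, one_smul, RCLike.ofReal_one, one_mul] at h2
    filter_upwards [Lp.coeFn_sub (∑ Q ∈ F, X Q) g, h2] with x h3 h4
    rw [h3, Pi.sub_apply, h4]
  · have h1 : ‖g‖ ≤ C₀ ^ p⁻¹ * (eLpNorm f (ENNReal.ofReal p) volume).toReal := by
      refine le_of_tendsto hg.norm (Eventually.of_forall fun F => ?_)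
      simpa using hbound F 1 (by simp)
    rw [Lp.norm_def] at h1
    have h2 := ENNReal.ofReal_le_ofReal h1
    rw [ENNReal.ofReal_toReal (Lp.eLpNorm_ne_top g), ENNReal.ofReal_mul (by positivity),
      ENNReal.ofReal_toReal hf.eLpNorm_ne_top] at h2
    refine h2.trans (le_of_eq ?_)
    congr 1
    exact ENNReal.ofReal_eq_coe_nnreal _
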